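/- Let $\alpha>0$, let $P_0$ be a probability measure without point masses ($P_0(\{\theta\})=0$ for every $\theta$) on a measurable space $(\Theta,\mathcal B)$ whose diagonal is measurable in $\Theta\times\Theta$ (e.g. a standard Borel space), and let $(\ell_{j,1})_{j\ge1}$, $(\ell_{j,2})_{j\ge1}$ be two fixed sequences in $\{0,1\}$ with $\sum_{j\ge1}\ell_{j,g}=\infty$ for $g=1,2$. Let $p_{1:2}=(p_1,p_2)\sim\text{thinned-DDP}(\alpha,P_0,\ell_{1:2})$, that is, $(p_1,p_2)$ is a pair of random probability measures with the joint law of $$p_g=\sum_{j\ge1}\Big[v_j\,\ell_{j,g}\prod_{h<j}(1-v_h\ell_{h,g})\Big]\delta_{\theta_j},\qquad g=1,2,$$ where $v_j\overset{\mathrm{iid}}{\sim}\mathrm{Beta}(1,\alpha)$ and $\theta_j\overset{\mathrm{iid}}{\sim}P_0$ are two independent sequences. Let $n_1,n_2\ge0$ and let $y_{1,1},\dots,y_{n_1,1},y_{1,2},\dots,y_{n_2,2}$ be conditionally independent given $p_{1:2}$, with $y_{i,g}\mid p_{1:2}\sim p_g$. Let $K(n_1,n_2;\ell_{1:2})$ be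 the total number of distinct values among these $n_1+n_2$ observations. Then $K(n_1,n_2;\ell_{1:2})$ is integrable and $$\sum_{i=1}^{n_1+n_2}\frac{\alpha}{\alpha+i-1}\;\le\;\mathbb E\big[K(n_1,n_2;\ell_{1:2})\big]\;\le\;\sum_{i=1}^{n_1}\frac{\alpha}{\alpha+i-1}+\sum_{i=1}^{n_2}\frac{\alpha}{\alpha+i-1}.$$ Here, for every $m\ge0$, $\sum_{i=1}^{m}\frac{\alpha}{\alpha+i-1}$ is the expected number of distinct values in a sample $x_1,\dots,x_m\mid p\overset{\mathrm{iid}}{\sim}p$ from a single Dirichlet process $p=\sum_{j\ge1}\big[v_j\prod_{h<j}(1-v_h)\big]\delta_{\theta_j}$ with concentration parameter $\alpha$ and base measure $P_0$, so the lower bound is the expected number of distinct values in one such sample of size $n_1+n_2$ and the upper bound is the sum of those for samples of sizes $n_1$ and $n_2$. -/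

import Mathlib

open MeasureTheory ProbabilityTheory
open scoped ENNReal

noncomputable section

namespace ThinnedDDP

/-- The weight `v_j ℓ_j ∏_{h<j} (1 - v_h ℓ_h)` obtained by thinning the stick-breaking variables `v`
by the `0`-`1` sequence `ℓ`. Positions are numbered from `0`. -/
def weight (ℓ : ℕ → ℕ) (v : ℕ → ℝ) (j : ℕ) : ℝ :=
  v j * (ℓ j : ℝ) * ∏ h ∈ Finset.range j, (1 - v h * (ℓ h : ℝ))

/-- The discrete measure `∑_j ω_j δ_{θ_j}`, where `ω` are the weights thinned by `ℓ`. -/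
def stickMeasure {Θ : Type*} [MeasurableSpace Θ] (ℓ : ℕ → ℕ) (v : ℕ → ℝ) (θ : ℕ → Θ) :
    Measure Θ :=
  Measure.sum fun j => ENNReal.ofReal (weight ℓ v j) • Measure.dirac (θ j)

/-- The joint law of the ingredients of the stick-breaking construction: `v_j` iid `Beta(1, α)`,
`θ_j` iid `P₀`, and the two sequences are independent. -/
def stickLaw {Θ : Type*} [MeasurableSpace Θ] (α : ℝ) (P₀ : Measure Θ) :
    Measure ((ℕ → ℝ) × (ℕ → Θ)) :=
  (Measure.infinitePi fun _ : ℕ => betaMeasure 1 α).prod (Measure.infinitePi fun _ : ℕ => P₀)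

/-- The law of the vector `(p_g)_g` with `p_g = ∑_j [v_j ℓ_{j,g} ∏_{h<j} (1 - v_h ℓ_{h,g})] δ_{θ_j}`,
all components being built from the same `v` and `θ`. -/
def thinnedDDPLaw {Θ ι : Type*} [MeasurableSpace Θ] (α : ℝ) (P₀ : Measure Θ) (ℓ : ι → ℕ → ℕ) :
    Measure (ι → Measure Θ) :=
  (stickLaw α P₀).map fun x g => stickMeasure (ℓ g) x.1 x.2

/-- The law of a Dirichlet process with concentration parameter `α` and base measure `P₀`: the
stick-breaking construction `p = ∑_j [v_j ∏_{h<j} (1 - v_h)] δ_{θ_j}`, without thinning. -/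
def dirichletProcessLaw {Θ : Type*} [MeasurableSpace Θ] (α : ℝ) (P₀ : Measure Θ) :
    Measure (Measure Θ) :=
  (stickLaw α P₀).map fun x => stickMeasure (fun _ => 1) x.1 x.2

/-- Thinning sequences: every `ℓ_{j,g}` is `0` or `1`, and `∑_j ℓ_{j,g} = ∞` for each `g`. -/
structure IsThinning {ι : Type*} (ℓ : ι → ℕ → ℕ) : Prop where
  zero_or_one : ∀ g j, ℓ g j = 0 ∨ ℓ g j = 1
  tsum_eq_top : ∀ g, ∑' j, (ℓ g j : ℝ≥0∞) = ∞

/-- `p_{1:G} ∼ thinned-DDP(α, P₀, ℓ_{1:G})` for a random vector `p` of measures. -/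
structure IsThinnedDDP {Ω Θ ι : Type*} [MeasurableSpace Ω] [MeasurableSpace Θ] (μ : Measure Ω)
    (α : ℝ) (P₀ : Measure Θ) (ℓ : ι → ℕ → ℕ) (p : Ω → ι → Measure Θ) : Prop where
  measurable : Measurable p
  map_eq : μ.map p = thinnedDDPLaw α P₀ ℓ

/-- `p ∼ DP(α, P₀)` for a random measure `p`. -/
structure IsDirichletProcess {Ω Θ : Type*} [MeasurableSpace Ω] [MeasurableSpace Θ] (μ : Measure Ω)
    (α : ℝ) (P₀ : Measure Θ) (p : Ω → Measure Θ) : Prop where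
  measurable : Measurable p
  map_eq : μ.map p = dirichletProcessLaw α P₀

/-- Samples from a vector of random probability measures: conditionally on `p`, all the variables
`y_{i,g}` are independent and `y_{i,g}` has distribution `p_g`. -/
structure IsSample {Ω Θ ι : Type*} [MeasurableSpace Ω] [MeasurableSpace Θ] [Fintype ι]
    (μ : Measure Ω) (p : Ω → ι → Measure Θ) {n : ι → ℕ} (y : (g : ι) → Fin (n g) → Ω → Θ) :
    Prop where
  measurable : ∀ g i, Measurable (y g i)
  condProb : ∀ A : (g : ι) → Fin (n g) → Set Θ, (∀ g i, MeasurableSet (A g i)) →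
    μ⟦{ω | ∀ g i, y g i ω ∈ A g i} | MeasurableSpace.comap p inferInstance⟧
      =ᵐ[μ] fun ω => ∏ g, ∏ i, (p ω g (A g i)).toReal

/-- The total number of distinct values among all the observations of all the samples. -/
def numDistinct {Ω Θ ι : Type*} {n : ι → ℕ} (y : (g : ι) → Fin (n g) → Ω → Θ) (ω : Ω) : ℕ :=
  {t : Θ | ∃ g i, y g i ω = t}.ncard

theorem measurable_weight (ℓ : ℕ → ℕ) (j : ℕ) : Measurable fun v : ℕ → ℝ => weight ℓ v j := by
  unfold weight
  fun_prop

/-- The stick-breaking map is measurable, so that the laws above are genuine image measures. -/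
theorem measurable_stickMeasure {Θ : Type*} [MeasurableSpace Θ] (ℓ : ℕ → ℕ) :
    Measurable fun x : (ℕ → ℝ) × (ℕ → Θ) => stickMeasure ℓ x.1 x.2 := by
  refine Measure.measurable_of_measurable_coe _ fun s hs => ?_
  simp only [stickMeasure, Measure.sum_apply _ hs, Measure.smul_apply, smul_eq_mul]
  refine Measurable.tsum fun j => ?_
  refine Measurable.mul ?_ ?_
  · exact ((measurable_weight ℓ j).comp measurable_fst).ennreal_ofReal
  · exact (Measure.measurable_coe hs).comp
      (Measure.measurable_dirac.comp ((measurable_pi_apply j).comp measurable_snd))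

/-- If `v_j` are iid `Beta(1, α)`, `θ_j` are iid `P₀`, and the two sequences are independent, then
the vector of random measures built from them is a thinned-DDP. -/
theorem isThinnedDDP_stickMeasure {Ω Θ ι : Type*} [MeasurableSpace Ω] [MeasurableSpace Θ]
    (μ : Measure Ω) [IsProbabilityMeasure μ] (α : ℝ) (P₀ : Measure Θ) (ℓ : ι → ℕ → ℕ)
    (v : ℕ → Ω → ℝ) (θ : ℕ → Ω → Θ) (hv : ∀ j, Measurable (v j)) (hθ : ∀ j, Measurable (θ j))
    (hv_law : ∀ j, μ.map (v j) = betaMeasure 1 α) (hθ_law : ∀ j, μ.map (θ j) = P₀)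
    (hv_indep : iIndepFun v μ) (hθ_indep : iIndepFun θ μ)
    (h_indep : IndepFun (fun ω j => v j ω) (fun ω j => θ j ω) μ) :
    IsThinnedDDP μ α P₀ ℓ
      (fun ω g => stickMeasure (ℓ g) (fun j => v j ω) (fun j => θ j ω)) := by
  have hvm : Measurable fun ω j => v j ω := measurable_pi_lambda _ hv
  have hθm : Measurable fun ω j => θ j ω := measurable_pi_lambda _ hθ
  have hF : Measurable fun (x : (ℕ → ℝ) × (ℕ → Θ)) (g : ι) => stickMeasure (ℓ g) x.1 x.2 :=
    measurable_pi_lambda _ fun g => measurable_stickMeasure (ℓ g)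
  have hp : Measurable fun ω (g : ι) =>
      stickMeasure (ℓ g) (fun j => v j ω) (fun j => θ j ω) := by
    refine measurable_pi_lambda _ fun g => ?_
    have hpair : Measurable fun ω => ((fun j => v j ω, fun j => θ j ω) : (ℕ → ℝ) × (ℕ → Θ)) :=
      Measurable.prodMk hvm hθm
    have := Measurable.comp (measurable_stickMeasure (Θ := Θ) (ℓ g)) hpair
    exact this
  refine ⟨hp, ?_⟩
  have h1 : μ.map (fun ω j => v j ω) = Measure.infinitePi fun _ : ℕ => betaMeasure 1 α :=
    ((iIndepFun_iff_map_fun_eq_infinitePi_map hv).1 hv_indep).trans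
      (congrArg Measure.infinitePi (funext hv_law))
  have h2 : μ.map (fun ω j => θ j ω) = Measure.infinitePi fun _ : ℕ => P₀ :=
    ((iIndepFun_iff_map_fun_eq_infinitePi_map hθ).1 hθ_indep).trans
      (congrArg Measure.infinitePi (funext hθ_law))
  have h3 := (indepFun_iff_map_prod_eq_prod_map_map hvm.aemeasurable hθm.aemeasurable).1 h_indep
  rw [thinnedDDPLaw, stickLaw, ← h1, ← h2, ← h3, Measure.map_map hF (hvm.prodMk hθm)]
  rfl

end ThinnedDDP

end

/-! Almost surely the atoms `θ_j` are distinct, so the number of distinct values is the number of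
atoms hit, and its mean is the sum over `j` of E[1 - (1 - w_{j,1})^{n₁} (1 - w_{j,2})^{n₂}], where
`w_{j,g}` are the thinned weights (`lintegral_numDistinct`). What remains is a statement about
sticks only.

For the lower bound, let R(s, t) be the integral of `hitProb a b (s * w) (t * w)` against w⁻¹
Beta(1, α)(dw), the mean intensity of the weights of a Dirichlet process (`remaining`). It serves as
a potential: s and t are the stick lengths left in the two components. A stick that breaks both
components satisfies R(s, t) = E[hit probability] + E[R at the shortened lengths]; a stick that
breaks neither changes nothing; a stick that breaks only one gives ≤, because shortening one length
alone decouples the groups (`integral_one_sub_mul_le`). Telescoping bounds R(1, 1) by the first J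
hit probabilities plus the mean of R at the remaining lengths. This mean vanishes, since R(s, t) ≤ a
s + b t and the expected lengths decay geometrically in the number of effective breaks. A geometric
sum identifies R(1, 1) with the harmonic-type sum (`remaining_one_one`).

For the upper bound, an atom is hit at most as often as the two groups hit it separately, and for a
single group the telescoping is exact (`hasSum_atomProb_self`). So thinning one sequence does not
change its expected count. -/

namespace ThinnedDDP

/-! ### Moments of the beta distribution and the recursion for its intensity. -/

section Beta

theorem ae_betaMeasure_mem_Ioo (a b : ℝ) : ∀ᵐ x ∂betaMeasure a b, x ∈ Set.Ioo (0 : ℝ) 1 := by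
  have hm : Measurable (betaPDF a b) := (measurable_betaPDFReal a b).ennreal_ofReal
  rw [betaMeasure, ae_withDensity_iff hm]
  refine Filter.Eventually.of_forall fun x hx => ?_
  by_contra h
  refine hx ?_
  rw [betaPDF_eq, if_neg (fun h' => h ⟨h'.1, h'.2⟩), ENNReal.ofReal_zero]

theorem betaPDFReal_nonneg {a b : ℝ} (ha : 0 < a) (hb : 0 < b) (x : ℝ) :
    0 ≤ betaPDFReal a b x := by
  by_cases h : 0 < x ∧ x < 1
  · exact (betaPDFReal_pos h.1 h.2 ha hb).le
  · rw [betaPDFReal, if_neg h]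

theorem integral_betaPDFReal {a b : ℝ} (ha : 0 < a) (hb : 0 < b) :
    ∫ x, betaPDFReal a b x = 1 := by
  rw [integral_eq_lintegral_of_nonneg_ae
    (Filter.Eventually.of_forall (betaPDFReal_nonneg ha hb)) (by fun_prop)]
  have := lintegral_betaPDF_eq_one ha hb
  unfold betaPDF at this
  rw [this, ENNReal.toReal_one]

/-- Mixed moments of the beta distribution. -/
theorem integral_pow_mul_pow_betaMeasure {a b : ℝ} (ha : 0 < a) (hb : 0 < b) (k l : ℕ) :
    ∫ x, x ^ k * (1 - x) ^ l ∂betaMeasure a b = beta (a + k) (b + l) / beta a b := by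
  have hm : Measurable (betaPDF a b) := (measurable_betaPDFReal a b).ennreal_ofReal
  have hak : 0 < a + k := by positivity
  have hbl : 0 < b + l := by positivity
  rw [betaMeasure, integral_withDensity_eq_integral_toReal_smul hm
    (Filter.Eventually.of_forall fun x => ENNReal.ofReal_lt_top)]
  calc ∫ x, (betaPDF a b x).toReal • (x ^ k * (1 - x) ^ l)
      = ∫ x, (beta (a + k) (b + l) / beta a b) * betaPDFReal (a + k) (b + l) x := by
        refine integral_congr_ae (Filter.Eventually.of_forall fun x => ?_)
        have h1 := (beta_pos ha hb).ne'
        have h2 := (beta_pos hak hbl).ne'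
        simp only [betaPDF, ENNReal.toReal_ofReal (betaPDFReal_nonneg ha hb x), smul_eq_mul]
        unfold betaPDFReal
        split_ifs with hx
        · have hx1 : 0 < 1 - x := by linarith [hx.2]
          rw [show a + k - 1 = (a - 1) + k by ring, show b + l - 1 = (b - 1) + l by ring,
            Real.rpow_add_natCast hx.1.ne', Real.rpow_add_natCast hx1.ne']
          field_simp
        · simp
    _ = _ := by rw [integral_const_mul, integral_betaPDFReal hak hbl, mul_one]

variable {α : ℝ}

theorem isProbabilityMeasure_betaMeasure_one (hα : 0 < α) :
    IsProbabilityMeasure (betaMeasure 1 α) :=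
  isProbabilityMeasureBeta one_pos hα

/-- These moments are the summands of the final formula, with `k` in the role of i - 1. -/
theorem integral_one_sub_pow_betaMeasure (hα : 0 < α) (k : ℕ) :
    ∫ x, (1 - x) ^ k ∂betaMeasure 1 α = α / (α + k) := by
  have h := integral_pow_mul_pow_betaMeasure one_pos hα 0 k
  simp only [pow_zero, one_mul, Nat.cast_zero, add_zero] at h
  have hk : 0 < α + k := by positivity
  rw [h, beta, beta, add_comm 1 α, add_comm 1 (α + k), Real.Gamma_add_one hα.ne',
    Real.Gamma_add_one hk.ne']
  have := (Real.Gamma_pos_of_pos hα).ne'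
  have := (Real.Gamma_pos_of_pos hk).ne'
  have := Real.Gamma_one
  field_simp

theorem integral_pow_succ_betaMeasure (hα : 0 < α) (k : ℕ) :
    ∫ x, x ^ (k + 1) ∂betaMeasure 1 α =
      (k + 1) / (α + (k + 1)) * ∫ x, x ^ k ∂betaMeasure 1 α := by
  have h0 := integral_pow_mul_pow_betaMeasure one_pos hα k 0
  have h1 := integral_pow_mul_pow_betaMeasure one_pos hα (k + 1) 0
  simp only [pow_zero, mul_one, Nat.cast_zero, add_zero] at h0 h1
  have hk : (0 : ℝ) < 1 + k := by positivity
  have hk' : (0 : ℝ) < 1 + k + α := by positivity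
  rw [h0, h1]
  simp only [beta, Nat.cast_add, Nat.cast_one]
  rw [show (1 : ℝ) + (k + 1) = (1 + k) + 1 by ring, show (1 : ℝ) + k + 1 + α = (1 + k + α) + 1 by ring,
    Real.Gamma_add_one hk.ne', Real.Gamma_add_one hk'.ne']
  have := (Real.Gamma_pos_of_pos hk).ne'
  have := (Real.Gamma_pos_of_pos hk').ne'
  have := (Real.Gamma_pos_of_pos hα).ne'
  have := (Real.Gamma_pos_of_pos (show 0 < 1 + α by positivity)).ne'
  have : α + (k + 1) ≠ 0 := by positivity
  rw [Real.Gamma_one]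
  field_simp
  ring

theorem integrable_of_continuous_betaMeasure (hα : 0 < α) {f : ℝ → ℝ} (hf : Continuous f) :
    Integrable f (betaMeasure 1 α) := by
  have := isProbabilityMeasure_betaMeasure_one hα
  obtain ⟨C, hC⟩ := isCompact_Icc.exists_bound_of_continuousOn
    (hf.continuousOn (s := Set.Icc (0 : ℝ) 1))
  refine Integrable.of_bound hf.aestronglyMeasurable C ?_
  filter_upwards [ae_betaMeasure_mem_Ioo 1 α] with x hx
  exact hC x ⟨hx.1.le, hx.2.le⟩

theorem ae_prod_betaMeasure_mem_Icc (hα : 0 < α) :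
    ∀ᵐ z ∂(betaMeasure 1 α).prod (betaMeasure 1 α),
      z ∈ Set.Icc (0 : ℝ) 1 ×ˢ Set.Icc (0 : ℝ) 1 := by
  have := isProbabilityMeasure_betaMeasure_one hα
  have h : ∀ᵐ x ∂betaMeasure 1 α, x ∈ Set.Icc (0 : ℝ) 1 :=
    (ae_betaMeasure_mem_Ioo 1 α).mono fun x hx => ⟨hx.1.le, hx.2.le⟩
  filter_upwards [Measure.quasiMeasurePreserving_fst.ae h,
    Measure.quasiMeasurePreserving_snd.ae h] with z h1 h2
  exact ⟨h1, h2⟩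

theorem integrable_of_continuous_prod_betaMeasure (hα : 0 < α) {f : ℝ × ℝ → ℝ}
    (hf : Continuous f) : Integrable f ((betaMeasure 1 α).prod (betaMeasure 1 α)) := by
  have := isProbabilityMeasure_betaMeasure_one hα
  obtain ⟨C, hC⟩ := (isCompact_Icc.prod isCompact_Icc).exists_bound_of_continuousOn
    (hf.continuousOn (s := Set.Icc (0 : ℝ) 1 ×ˢ Set.Icc (0 : ℝ) 1))
  exact Integrable.of_bound hf.aestronglyMeasurable C
    ((ae_prod_betaMeasure_mem_Icc hα).mono fun z hz => hC z hz)

/-- The stick-breaking recursion for the intensity `w⁻¹ Beta(1, α)(dw)` of the weights. -/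
theorem integral_eval_stick_recursion (hα : 0 < α) (D : Polynomial ℝ) :
    ∫ w, D.eval w ∂betaMeasure 1 α = ∫ v, v * D.eval v ∂betaMeasure 1 α +
      ∫ z, (1 - z.1) * D.eval ((1 - z.1) * z.2) ∂(betaMeasure 1 α).prod (betaMeasure 1 α) := by
  have := isProbabilityMeasure_betaMeasure_one hα
  induction D using Polynomial.induction_on' with
  | add p q hp hq =>
    simp only [Polynomial.eval_add, mul_add]
    rw [integral_add, integral_add, integral_add, hp, hq]
    · ring
    all_goals first
      | exact integrable_of_continuous_prod_betaMeasure hα (by fun_prop)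
      | exact integrable_of_continuous_betaMeasure hα (by fun_prop)
  | monomial k c =>
    simp only [Polynomial.eval_monomial]
    have h1 : ∀ v : ℝ, v * (c * v ^ k) = c * v ^ (k + 1) := fun v => by ring
    have h2 : ∀ z : ℝ × ℝ, (1 - z.1) * (c * ((1 - z.1) * z.2) ^ k) =
        (c * (1 - z.1) ^ (k + 1)) * z.2 ^ k := fun z => by rw [mul_pow]; ring
    simp only [h1, h2]
    -- Independence factorises the last term, and every term becomes a multiple of the k-th moment;
    -- the claim is then 1 = (k+1)/(α+k+1) + α/(α+k+1).
    rw [integral_prod_mul (fun v : ℝ => c * (1 - v) ^ (k + 1)) (fun w : ℝ => w ^ k)]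
    simp only [integral_const_mul]
    rw [integral_one_sub_pow_betaMeasure hα, integral_pow_succ_betaMeasure hα]
    have : α + (k + 1) ≠ 0 := by positivity
    push_cast
    field_simp
    ring

end Beta

/-! ### Hit probabilities and the potential of the unbroken sticks. -/

section Occupancy

/-- The probability that an atom is hit by at least one of `a + b` independent draws, if each of
the first `a` hits it with probability `x` and each of the other `b` with probability `y`. -/
def hitProb (a b : ℕ) (x y : ℝ) : ℝ := 1 - (1 - x) ^ a * (1 - y) ^ b

theorem hitProb_nonneg (a b : ℕ) {x y : ℝ} (hx : x ∈ Set.Icc (0 : ℝ) 1)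
    (hy : y ∈ Set.Icc (0 : ℝ) 1) : 0 ≤ hitProb a b x y := by
  have h1 : 0 ≤ 1 - x := by linarith [hx.2]
  have h2 : 0 ≤ 1 - y := by linarith [hy.2]
  have := mul_le_one₀ (pow_le_one₀ h1 (by linarith [hx.1] : 1 - x ≤ 1) (n := a))
    (pow_nonneg h2 b) (pow_le_one₀ h2 (by linarith [hy.1] : 1 - y ≤ 1))
  unfold hitProb
  linarith

theorem hitProb_le_one (a b : ℕ) {x y : ℝ} (hx : x ∈ Set.Icc (0 : ℝ) 1)
    (hy : y ∈ Set.Icc (0 : ℝ) 1) : hitProb a b x y ≤ 1 := by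
  have h1 : 0 ≤ 1 - x := by linarith [hx.2]
  have h2 : 0 ≤ 1 - y := by linarith [hy.2]
  unfold hitProb
  have := mul_nonneg (pow_nonneg h1 a) (pow_nonneg h2 b)
  linarith

/-- Union bound over the two groups: with P and Q the two miss probabilities, it says (1 - P)(1 - Q)
≥ 0. -/
theorem hitProb_le_add (a b : ℕ) {x y : ℝ} (hx : x ∈ Set.Icc (0 : ℝ) 1)
    (hy : y ∈ Set.Icc (0 : ℝ) 1) : hitProb a b x y ≤ hitProb a 0 x 0 + hitProb b 0 y 0 := by
  have h1 : 0 ≤ 1 - x := by linarith [hx.2]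
  have h2 : 0 ≤ 1 - y := by linarith [hy.2]
  have h3 := pow_le_one₀ h1 (by linarith [hx.1] : 1 - x ≤ 1) (n := a)
  have h4 := pow_le_one₀ h2 (by linarith [hy.1] : 1 - y ≤ 1) (n := b)
  simp only [hitProb, pow_zero, mul_one]
  nlinarith

theorem hitProb_zero_le (a : ℕ) {x : ℝ} (hx : x ∈ Set.Icc (0 : ℝ) 1) :
    hitProb a 0 x 0 ≤ a * x := by
  have := one_add_mul_le_pow (a := -x) (by linarith [hx.2]) a
  simp only [hitProb, pow_zero, mul_one]
  rw [← sub_eq_add_neg] at this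
  linarith

theorem hitProb_le_mul (a b : ℕ) {x y : ℝ} (hx : x ∈ Set.Icc (0 : ℝ) 1)
    (hy : y ∈ Set.Icc (0 : ℝ) 1) : hitProb a b x y ≤ a * x + b * y :=
  (hitProb_le_add a b hx hy).trans (add_le_add (hitProb_zero_le a hx) (hitProb_zero_le b hy))

@[fun_prop]
theorem continuous_hitProb (a b : ℕ) : Continuous fun z : ℝ × ℝ => hitProb a b z.1 z.2 := by
  unfold hitProb
  fun_prop

theorem measurable_hitProb {X : Type*} [MeasurableSpace X] (a b : ℕ) {f g : X → ℝ}
    (hf : Measurable f) (hg : Measurable g) : Measurable fun x => hitProb a b (f x) (g x) :=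
  (continuous_hitProb a b).measurable.comp (hf.prodMk hg)

/-- The expected number of distinct values among `a + b` draws of which each of the first `a`
(other `b`) comes with probability `s` (`t`) from a Dirichlet process that both groups share, draws
not coming from it being discarded. -/
noncomputable def remaining (α : ℝ) (a b : ℕ) (s t : ℝ) : ℝ :=
  ∫ w, hitProb a b (s * w) (t * w) / w ∂betaMeasure 1 α

variable {α : ℝ}

theorem mul_mem_Icc {s w : ℝ} (hs : s ∈ Set.Icc (0 : ℝ) 1) (hw : w ∈ Set.Icc (0 : ℝ) 1) :
    s * w ∈ Set.Icc (0 : ℝ) 1 :=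
  ⟨mul_nonneg hs.1 hw.1, mul_le_one₀ hs.2 hw.1 hw.2⟩

theorem one_sub_mem_Icc {s : ℝ} (hs : s ∈ Set.Icc (0 : ℝ) 1) : 1 - s ∈ Set.Icc (0 : ℝ) 1 :=
  ⟨by linarith [hs.2], by linarith [hs.1]⟩

/-- Bernoulli's inequality absorbs the singularity 1/w. Linearity of the bound in `s` and `t` is
what later makes the remainder vanish. -/
theorem hitProb_div_mem (a b : ℕ) {s t w : ℝ} (hs : s ∈ Set.Icc (0 : ℝ) 1)
    (ht : t ∈ Set.Icc (0 : ℝ) 1) (hw : w ∈ Set.Icc (0 : ℝ) 1) :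
    hitProb a b (s * w) (t * w) / w ∈ Set.Icc 0 (a * s + b * t) := by
  have hsw := mul_mem_Icc hs hw
  have htw := mul_mem_Icc ht hw
  refine ⟨div_nonneg (hitProb_nonneg a b hsw htw) hw.1, ?_⟩
  rcases hw.1.eq_or_lt with h | h
  -- At w = 0 the quotient is 0 by the convention for division.
  · subst h
    have := hs.1
    have := ht.1
    simp only [div_zero]
    positivity
  · rw [div_le_iff₀ h]
    exact (hitProb_le_mul a b hsw htw).trans_eq (by ring)

theorem abs_hitProb_div_le (a b : ℕ) {s t w : ℝ} (hs : s ∈ Set.Icc (0 : ℝ) 1)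
    (ht : t ∈ Set.Icc (0 : ℝ) 1) (hw : w ∈ Set.Icc (0 : ℝ) 1) :
    ‖hitProb a b (s * w) (t * w) / w‖ ≤ a + b := by
  have h := hitProb_div_mem a b hs ht hw
  rw [Real.norm_of_nonneg h.1]
  refine h.2.trans (add_le_add ?_ ?_)
  · exact mul_le_of_le_one_right (by positivity) hs.2
  · exact mul_le_of_le_one_right (by positivity) ht.2

theorem ae_betaMeasure_mem_Icc (a b : ℝ) : ∀ᵐ x ∂betaMeasure a b, x ∈ Set.Icc (0 : ℝ) 1 :=
  (ae_betaMeasure_mem_Ioo a b).mono fun _ hx => ⟨hx.1.le, hx.2.le⟩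

theorem remaining_mem (hα : 0 < α) (a b : ℕ) {s t : ℝ} (hs : s ∈ Set.Icc (0 : ℝ) 1)
    (ht : t ∈ Set.Icc (0 : ℝ) 1) : remaining α a b s t ∈ Set.Icc 0 (a * s + b * t) := by
  have := isProbabilityMeasure_betaMeasure_one hα
  have h : ∀ᵐ w ∂betaMeasure 1 α, hitProb a b (s * w) (t * w) / w ∈ Set.Icc 0 (a * s + b * t) :=
    (ae_betaMeasure_mem_Icc 1 α).mono fun w hw => hitProb_div_mem a b hs ht hw
  refine ⟨integral_nonneg_of_ae (h.mono fun w hw => hw.1), ?_⟩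
  have h2 := integral_mono_of_nonneg (h.mono fun w hw => hw.1)
    (integrable_const (a * s + b * t)) (h.mono fun w hw => hw.2)
  simpa [remaining] using h2

theorem measurable_hitProb_div {X : Type*} [MeasurableSpace X] (a b : ℕ) {f g h : X → ℝ}
    (hf : Measurable f) (hg : Measurable g) (hh : Measurable h) :
    Measurable fun x => hitProb a b (f x * h x) (g x * h x) / h x :=
  (measurable_hitProb a b (hf.mul hh) (hg.mul hh)).div hh

theorem measurable_remaining {X : Type*} [MeasurableSpace X] (hα : 0 < α) (a b : ℕ) {f g : X → ℝ}
    (hf : Measurable f) (hg : Measurable g) :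
    Measurable fun x => remaining α a b (f x) (g x) := by
  have := isProbabilityMeasure_betaMeasure_one hα
  have h : StronglyMeasurable fun z : X × ℝ =>
      hitProb a b (f z.1 * z.2) (g z.1 * z.2) / z.2 :=
    (measurable_hitProb_div a b (hf.comp measurable_fst) (hg.comp measurable_fst)
      measurable_snd).stronglyMeasurable
  exact (h.integral_prod_right (ν := betaMeasure 1 α)).measurable

/-- (1 - (1 - w)^m) / w is the geometric sum of (1 - w)^i over i < m, which is integrated term by
term. -/
theorem remaining_one_one (hα : 0 < α) (a b : ℕ) :
    remaining α a b 1 1 = ∑ i ∈ Finset.Icc 1 (a + b), α / (α + (i : ℝ) - 1) := by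
  have h : remaining α a b 1 1 =
      ∫ w, ∑ i ∈ Finset.range (a + b), (1 - w) ^ i ∂betaMeasure 1 α := by
    refine integral_congr_ae ?_
    filter_upwards [ae_betaMeasure_mem_Ioo 1 α] with w hw
    have hw0 := hw.1.ne'
    have := geom_sum_mul (1 - w) (a + b)
    rw [div_eq_iff hw0]
    simp only [hitProb, one_mul, ← pow_add]
    linarith
  rw [h, integral_finsetSum _ fun i _ =>
    integrable_of_continuous_betaMeasure hα (by fun_prop)]
  rw [Finset.sum_congr rfl fun i _ => integral_one_sub_pow_betaMeasure hα i]
  induction a + b with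
  | zero => simp
  | succ m ih =>
    rw [Finset.sum_range_succ, Finset.sum_Icc_succ_top (by omega), ih]
    push_cast
    congr 2
    ring

/-- Since 1 - A vanishes at 0, it is X times a polynomial, so the singular 1/w cancels and the
polynomial recursion applies to the quotient. -/
theorem integral_one_sub_eval_recursion (hα : 0 < α) (A : Polynomial ℝ) (hA : A.eval 0 = 1) :
    ∫ w, (1 - A.eval w) / w ∂betaMeasure 1 α = ∫ v, (1 - A.eval v) ∂betaMeasure 1 α +
      ∫ z, (1 - A.eval ((1 - z.1) * z.2)) / z.2 ∂(betaMeasure 1 α).prod (betaMeasure 1 α) := by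
  have := isProbabilityMeasure_betaMeasure_one hα
  have hD : ∀ x, 1 - A.eval x = x * (-A.divX).eval x := fun x => by
    conv_lhs => rw [← A.divX_mul_X_add]
    rw [Polynomial.coeff_zero_eq_eval_zero, hA]
    simp
    ring
  have h1 : ∫ w, (1 - A.eval w) / w ∂betaMeasure 1 α =
      ∫ w, (-A.divX).eval w ∂betaMeasure 1 α := by
    refine integral_congr_ae ?_
    filter_upwards [ae_betaMeasure_mem_Ioo 1 α] with w hw
    rw [hD, mul_div_cancel_left₀ _ hw.1.ne']
  have h2 : ∫ z, (1 - A.eval ((1 - z.1) * z.2)) / z.2 ∂(betaMeasure 1 α).prod (betaMeasure 1 α) =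
      ∫ z, (1 - z.1) * (-A.divX).eval ((1 - z.1) * z.2)
        ∂(betaMeasure 1 α).prod (betaMeasure 1 α) := by
    refine integral_congr_ae ?_
    filter_upwards [Measure.quasiMeasurePreserving_snd.ae (ae_betaMeasure_mem_Ioo 1 α)] with z hz
    have := hz.1.ne'
    rw [hD]
    field_simp
  rw [h1, h2, integral_eval_stick_recursion hα]
  simp only [hD]

/-- If only one of two factors is thinned by a stick, the recursion becomes an inequality. -/
theorem integral_one_sub_mul_le (hα : 0 < α) (A B : Polynomial ℝ) (hA : A.eval 0 = 1)
    (hB : B.eval 0 = 1) (hanti : AntitoneOn (fun x => A.eval x) (Set.Icc 0 1))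
    (hB1 : ∀ x ∈ Set.Icc (0 : ℝ) 1, B.eval x ≤ 1) :
    ∫ w, (1 - A.eval w * B.eval w) / w ∂betaMeasure 1 α ≤
      ∫ v, (1 - A.eval v) ∂betaMeasure 1 α +
      ∫ z, (1 - A.eval ((1 - z.1) * z.2) * B.eval z.2) / z.2
        ∂(betaMeasure 1 α).prod (betaMeasure 1 α) := by
  have := isProbabilityMeasure_betaMeasure_one hα
  have key : ∀ P : Polynomial ℝ, P.eval 0 = 1 → ∃ D : Polynomial ℝ, ∀ x,
      1 - P.eval x = x * D.eval x := fun P hP => ⟨-P.divX, fun x => by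
    conv_lhs => rw [← P.divX_mul_X_add]
    rw [Polynomial.coeff_zero_eq_eval_zero, hP]
    simp
    ring⟩
  obtain ⟨DA, hDA⟩ := key A hA
  obtain ⟨DB, hDB⟩ := key B hB
  have hpos : ∀ᵐ z ∂(betaMeasure 1 α).prod (betaMeasure 1 α), z.2 ∈ Set.Ioo (0 : ℝ) 1 :=
    Measure.quasiMeasurePreserving_snd.ae (ae_betaMeasure_mem_Ioo 1 α)
  -- Split 1 - AB = (1 - A) + A(1 - B). The first part obeys the exact recursion; only the second
  -- part loses equality.
  have h1 : ∫ w, (1 - A.eval w * B.eval w) / w ∂betaMeasure 1 α =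
      ∫ w, (1 - A.eval w) / w ∂betaMeasure 1 α +
      ∫ w, A.eval w * DB.eval w ∂betaMeasure 1 α := by
    rw [← integral_add]
    · refine integral_congr_ae ?_
      filter_upwards [ae_betaMeasure_mem_Ioo 1 α] with w hw
      have := hw.1.ne'
      have := hDB w
      field_simp
      linear_combination A.eval w * this
    · refine (integrable_of_continuous_betaMeasure hα (f := fun w => DA.eval w)
        (by fun_prop)).congr ?_
      filter_upwards [ae_betaMeasure_mem_Ioo 1 α] with w hw
      rw [hDA, mul_div_cancel_left₀ _ hw.1.ne']
    · exact integrable_of_continuous_betaMeasure hα (by fun_prop)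
  have h2 : ∫ z, (1 - A.eval ((1 - z.1) * z.2) * B.eval z.2) / z.2
        ∂(betaMeasure 1 α).prod (betaMeasure 1 α) =
      ∫ z, (1 - A.eval ((1 - z.1) * z.2)) / z.2 ∂(betaMeasure 1 α).prod (betaMeasure 1 α) +
      ∫ z, A.eval ((1 - z.1) * z.2) * DB.eval z.2
        ∂(betaMeasure 1 α).prod (betaMeasure 1 α) := by
    rw [← integral_add]
    · refine integral_congr_ae ?_
      filter_upwards [hpos] with z hz
      have := hz.1.ne'
      have := hDB z.2
      field_simp
      linear_combination A.eval ((1 - z.1) * z.2) * this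
    · refine (integrable_of_continuous_prod_betaMeasure hα
        (f := fun z => (1 - z.1) * DA.eval ((1 - z.1) * z.2)) (by fun_prop)).congr ?_
      filter_upwards [hpos] with z hz
      have := hz.1.ne'
      rw [hDA]
      field_simp
    · exact integrable_of_continuous_prod_betaMeasure hα (by fun_prop)
  -- Shrinking the argument of the decreasing A raises its value, while `DB`, which is (1 - B)/w,
  -- stays nonnegative. The left side is lifted to the product space by a dummy stick.
  have h3 : ∫ w, A.eval w * DB.eval w ∂betaMeasure 1 α ≤
      ∫ z, A.eval ((1 - z.1) * z.2) * DB.eval z.2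
        ∂(betaMeasure 1 α).prod (betaMeasure 1 α) := by
    have : ∫ w, A.eval w * DB.eval w ∂betaMeasure 1 α =
        ∫ z, A.eval z.2 * DB.eval z.2 ∂(betaMeasure 1 α).prod (betaMeasure 1 α) := by
      rw [integral_fun_snd (fun w => A.eval w * DB.eval w)]
      simp
    rw [this]
    refine integral_mono_ae (integrable_of_continuous_prod_betaMeasure hα (by fun_prop))
      (integrable_of_continuous_prod_betaMeasure hα (by fun_prop)) ?_
    filter_upwards [hpos, ae_prod_betaMeasure_mem_Icc hα] with z hz hz'
    have hw : z.2 ∈ Set.Icc (0 : ℝ) 1 := hz'.2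
    have hD : 0 ≤ DB.eval z.2 := by
      have := hDB z.2
      have := hB1 z.2 hw
      exact nonneg_of_mul_nonneg_right (by linarith : 0 ≤ z.2 * DB.eval z.2) hz.1
    refine mul_le_mul_of_nonneg_right ?_ hD
    have h1z := one_sub_mem_Icc hz'.1
    exact hanti (mul_mem_Icc h1z hw) hw (mul_le_of_le_one_left hw.1 h1z.2)
  rw [h1, h2, integral_one_sub_eval_recursion hα A hA]
  linarith

theorem eval_one_sub_C_mul_X_pow (s w : ℝ) (a : ℕ) :
    ((1 - Polynomial.C s * Polynomial.X) ^ a : Polynomial ℝ).eval w = (1 - s * w) ^ a := by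
  simp

theorem integral_prod_hitProb_div (hα : 0 < α) (a b : ℕ) {f g : ℝ → ℝ} (hf : Measurable f)
    (hg : Measurable g) (hf1 : ∀ v ∈ Set.Icc (0 : ℝ) 1, f v ∈ Set.Icc (0 : ℝ) 1)
    (hg1 : ∀ v ∈ Set.Icc (0 : ℝ) 1, g v ∈ Set.Icc (0 : ℝ) 1) :
    ∫ z, hitProb a b (f z.1 * z.2) (g z.1 * z.2) / z.2 ∂(betaMeasure 1 α).prod (betaMeasure 1 α) =
      ∫ v, remaining α a b (f v) (g v) ∂betaMeasure 1 α := by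
  have := isProbabilityMeasure_betaMeasure_one hα
  refine integral_prod _ (Integrable.of_bound (C := a + b) ?_ ?_)
  · exact (measurable_hitProb_div a b (hf.comp measurable_fst) (hg.comp measurable_fst)
      measurable_snd).aestronglyMeasurable
  · filter_upwards [ae_prod_betaMeasure_mem_Icc hα] with z hz
    exact abs_hitProb_div_le a b (hf1 _ hz.1) (hg1 _ hz.1) hz.2

theorem remaining_comm (α : ℝ) (a b : ℕ) (s t : ℝ) :
    remaining α a b s t = remaining α b a t s := by
  simp only [remaining, hitProb, mul_comm]

/-- The whole miss probability is one polynomial in w, so a stick common to both components rescales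
w alone. -/
theorem remaining_eq_of_both (hα : 0 < α) (a b : ℕ) {s t : ℝ} (hs : s ∈ Set.Icc (0 : ℝ) 1)
    (ht : t ∈ Set.Icc (0 : ℝ) 1) :
    remaining α a b s t = ∫ v, hitProb a b (s * v) (t * v) ∂betaMeasure 1 α +
      ∫ v, remaining α a b (s * (1 - v)) (t * (1 - v)) ∂betaMeasure 1 α := by
  have h := integral_one_sub_eval_recursion hα
    ((1 - Polynomial.C s * Polynomial.X) ^ a * (1 - Polynomial.C t * Polynomial.X) ^ b) (by simp)
  simp only [Polynomial.eval_mul, eval_one_sub_C_mul_X_pow, ← mul_assoc] at h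
  rw [← integral_prod_hitProb_div hα a b (by fun_prop) (by fun_prop)
    (fun v hv => mul_mem_Icc hs (one_sub_mem_Icc hv))
    (fun v hv => mul_mem_Icc ht (one_sub_mem_Icc hv))]
  exact h

/-- The miss probability of the first group is the rescaled factor A, that of the second the
untouched factor B. -/
theorem remaining_le_of_left (hα : 0 < α) (a b : ℕ) {s t : ℝ} (hs : s ∈ Set.Icc (0 : ℝ) 1)
    (ht : t ∈ Set.Icc (0 : ℝ) 1) :
    remaining α a b s t ≤ ∫ v, hitProb a b (s * v) 0 ∂betaMeasure 1 α +
      ∫ v, remaining α a b (s * (1 - v)) t ∂betaMeasure 1 α := by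
  have h := integral_one_sub_mul_le hα ((1 - Polynomial.C s * Polynomial.X) ^ a)
    ((1 - Polynomial.C t * Polynomial.X) ^ b) (by simp) (by simp) ?_ ?_
  · simp only [eval_one_sub_C_mul_X_pow, ← mul_assoc] at h
    rw [← integral_prod_hitProb_div hα a b (g := fun _ => t) (by fun_prop) (by fun_prop)
      (fun v hv => mul_mem_Icc hs (one_sub_mem_Icc hv)) (fun v hv => ht)]
    simpa only [remaining, hitProb, sub_zero, one_pow, mul_one] using h
  · intro x hx y hy hxy
    simp only [eval_one_sub_C_mul_X_pow]
    have := (mul_mem_Icc hs hy).2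
    have := mul_le_mul_of_nonneg_left hxy hs.1
    exact pow_le_pow_left₀ (by linarith) (by linarith) a
  · intro x hx
    rw [eval_one_sub_C_mul_X_pow]
    have := mul_mem_Icc ht hx
    exact pow_le_one₀ (by linarith [this.2]) (by linarith [this.1])

/-- One stick, present in the first (second) component if `e = 1` (`f = 1`). -/
theorem remaining_le_step (hα : 0 < α) (a b : ℕ) {s t : ℝ} (hs : s ∈ Set.Icc (0 : ℝ) 1)
    (ht : t ∈ Set.Icc (0 : ℝ) 1) {e f : ℕ} (he : e = 0 ∨ e = 1) (hf : f = 0 ∨ f = 1) :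
    remaining α a b s t ≤
      ∫ v, hitProb a b (v * e * s) (v * f * t) ∂betaMeasure 1 α +
      ∫ v, remaining α a b (s * (1 - v * e)) (t * (1 - v * f)) ∂betaMeasure 1 α := by
  have := isProbabilityMeasure_betaMeasure_one hα
  rcases he with rfl | rfl <;> rcases hf with rfl | rfl <;>
    simp only [Nat.cast_zero, Nat.cast_one, mul_zero, mul_one, zero_mul, sub_zero]
  · simp [hitProb]
  -- The stick breaks only the second component: exchange the groups.
  · have h := remaining_le_of_left hα b a ht hs
    simp only [mul_comm _ t, remaining_comm α a b] at h ⊢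
    refine h.trans_eq ?_
    simp [hitProb]
  · simpa only [mul_comm _ s] using remaining_le_of_left hα a b hs ht
  · simpa only [mul_comm _ s, mul_comm _ t] using (remaining_eq_of_both hα a b hs ht).le

/-- With an empty second group its length is immaterial. Taking it equal to the first excludes the
one-sided case, so no inequality arises. -/
theorem remaining_eq_step (hα : 0 < α) (a : ℕ) {s : ℝ} (hs : s ∈ Set.Icc (0 : ℝ) 1)
    {e : ℕ} (he : e = 0 ∨ e = 1) :
    remaining α a 0 s s =
      ∫ v, hitProb a 0 (v * e * s) (v * e * s) ∂betaMeasure 1 α +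
      ∫ v, remaining α a 0 (s * (1 - v * e)) (s * (1 - v * e)) ∂betaMeasure 1 α := by
  have := isProbabilityMeasure_betaMeasure_one hα
  rcases he with rfl | rfl <;>
    simp only [Nat.cast_zero, Nat.cast_one, mul_zero, mul_one, zero_mul, sub_zero]
  · simp [hitProb]
  · simpa only [mul_comm _ s] using remaining_eq_of_both hα a 0 hs hs

end Occupancy

/-! ### Thinned stick-breaking: independence, exhaustion of the stick, telescoping. -/

section Sticks

/-- The law of the stick-breaking proportions. -/
noncomputable abbrev propLaw (α : ℝ) : Measure (ℕ → ℝ) :=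
  Measure.infinitePi fun _ : ℕ => betaMeasure 1 α

/-- The length of the stick that is left after the first `J` breaks. -/
def stickRest (ℓ : ℕ → ℕ) (J : ℕ) (v : ℕ → ℝ) : ℝ :=
  ∏ h ∈ Finset.range J, (1 - v h * (ℓ h : ℝ))

theorem weight_eq (ℓ : ℕ → ℕ) (v : ℕ → ℝ) (J : ℕ) :
    weight ℓ v J = v J * ℓ J * stickRest ℓ J v := rfl

theorem stickRest_succ (ℓ : ℕ → ℕ) (J : ℕ) (v : ℕ → ℝ) :
    stickRest ℓ (J + 1) v = stickRest ℓ J v * (1 - v J * ℓ J) :=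
  Finset.prod_range_succ _ _

theorem sum_weight (ℓ : ℕ → ℕ) (v : ℕ → ℝ) (J : ℕ) :
    ∑ j ∈ Finset.range J, weight ℓ v j = 1 - stickRest ℓ J v := by
  induction J with
  | zero => simp [stickRest]
  | succ J ih => rw [Finset.sum_range_succ, ih, stickRest_succ, weight_eq]; ring

@[fun_prop]
theorem measurable_stickRest (ℓ : ℕ → ℕ) (J : ℕ) : Measurable (stickRest ℓ J) := by
  unfold stickRest
  fun_prop

/-- The length left before break `J` involves only earlier proportions; this is where the
independence of `v J` from the past enters. -/
theorem stickRest_update (ℓ : ℕ → ℕ) (J : ℕ) (v : ℕ → ℝ) (x : ℝ) :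
    stickRest ℓ J (Function.update v J x) = stickRest ℓ J v := by
  refine Finset.prod_congr rfl fun h hh => ?_
  rw [Function.update_of_ne (Finset.mem_range.1 hh).ne]

theorem mul_thin_mem_Icc {x : ℝ} (hx : x ∈ Set.Icc (0 : ℝ) 1) {e : ℕ} (he : e = 0 ∨ e = 1) :
    x * e ∈ Set.Icc (0 : ℝ) 1 := by
  rcases he with rfl | rfl
  · simp
  · simpa using hx

theorem stickRest_mem {ℓ : ℕ → ℕ} (hℓ : ∀ j, ℓ j = 0 ∨ ℓ j = 1) {v : ℕ → ℝ}
    (hv : ∀ j, v j ∈ Set.Icc (0 : ℝ) 1) (J : ℕ) : stickRest ℓ J v ∈ Set.Icc (0 : ℝ) 1 := by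
  induction J with
  | zero => simp [stickRest]
  | succ J ih =>
    rw [stickRest_succ]
    exact mul_mem_Icc ih (one_sub_mem_Icc (mul_thin_mem_Icc (hv J) (hℓ J)))

theorem weight_mem {ℓ : ℕ → ℕ} (hℓ : ∀ j, ℓ j = 0 ∨ ℓ j = 1) {v : ℕ → ℝ}
    (hv : ∀ j, v j ∈ Set.Icc (0 : ℝ) 1) (J : ℕ) : weight ℓ v J ∈ Set.Icc (0 : ℝ) 1 :=
  mul_mem_Icc (mul_thin_mem_Icc (hv J) (hℓ J)) (stickRest_mem hℓ hv J)

/-- Replacing one coordinate by an independent copy does not change an infinite product law. -/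
theorem measurePreserving_update_infinitePi {X : Type*} [MeasurableSpace X] (P : Measure X)
    [IsProbabilityMeasure P] (J : ℕ) :
    MeasurePreserving (fun z : (ℕ → X) × X => Function.update z.1 J z.2)
      ((Measure.infinitePi fun _ : ℕ => P).prod P) (Measure.infinitePi fun _ : ℕ => P) := by
  have hm : Measurable fun z : (ℕ → X) × X => Function.update z.1 J z.2 :=
    measurable_pi_lambda _ fun i => by
      rcases eq_or_ne i J with rfl | h
      · simpa using measurable_snd
      · simp only [Function.update_of_ne h]
        fun_prop
  refine ⟨hm, Measure.eq_infinitePi _ fun s t ht => ?_⟩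
  classical
  have hpre : (fun z : (ℕ → X) × X => Function.update z.1 J z.2) ⁻¹' (Set.pi s t) =
      (Set.pi (s.erase J) t) ×ˢ (if J ∈ s then t J else Set.univ) := by
    ext ⟨v, x⟩
    simp only [Set.mem_preimage, Set.mem_pi, Finset.mem_coe, Set.mem_prod, Finset.mem_erase]
    constructor
    · refine fun h => ⟨fun i hi => by simpa [Function.update_of_ne hi.1] using h i hi.2, ?_⟩
      split_ifs with hJ
      · simpa using h J hJ
      · trivial
    · rintro ⟨h1, h2⟩ i hi
      rcases eq_or_ne i J with rfl | h
      · simpa [hi] using h2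
      · simpa [Function.update_of_ne h] using h1 i ⟨h, hi⟩
  rw [Measure.map_apply hm (MeasurableSet.pi s.countable_toSet fun i _ => ht i), hpre,
    Measure.prod_prod, Measure.infinitePi_pi _ fun i _ => ht i]
  split_ifs with hJ
  · rw [mul_comm, Finset.mul_prod_erase s (fun i => P (t i)) hJ]
  · rw [measure_univ, mul_one, Finset.erase_eq_of_notMem hJ]

variable {α : ℝ}

theorem ae_propLaw_mem (hα : 0 < α) : ∀ᵐ v ∂propLaw α, ∀ j, v j ∈ Set.Icc (0 : ℝ) 1 := by
  have := isProbabilityMeasure_betaMeasure_one hα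
  rw [ae_all_iff]
  exact fun j => (measurePreserving_eval_infinitePi (fun _ : ℕ => betaMeasure 1 α)
    j).quasiMeasurePreserving.ae (ae_betaMeasure_mem_Icc 1 α)

/-- Resampling coordinate `J` and applying Fubini replaces conditioning on all other proportions. -/
theorem integral_propLaw_eq (hα : 0 < α) (J : ℕ) {F : (ℕ → ℝ) → ℝ} (hF : Measurable F) {C : ℝ}
    (hC : ∀ᵐ v ∂propLaw α, ‖F v‖ ≤ C) :
    Integrable (fun v => ∫ x, F (Function.update v J x) ∂betaMeasure 1 α) (propLaw α) ∧
    ∫ v, F v ∂propLaw α =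
      ∫ v, ∫ x, F (Function.update v J x) ∂betaMeasure 1 α ∂propLaw α := by
  have := isProbabilityMeasure_betaMeasure_one hα
  have hmp := measurePreserving_update_infinitePi (betaMeasure 1 α) J
  have hint : Integrable (fun z : (ℕ → ℝ) × ℝ => F (Function.update z.1 J z.2))
      ((propLaw α).prod (betaMeasure 1 α)) :=
    Integrable.of_bound (hF.comp hmp.measurable).aestronglyMeasurable C
      (hmp.quasiMeasurePreserving.ae hC)
  refine ⟨hint.integral_prod_left, ?_⟩
  rw [← integral_prod (fun z : (ℕ → ℝ) × ℝ => F (Function.update z.1 J z.2)) hint]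
  conv_lhs => rw [propLaw, ← hmp.map_eq]
  exact integral_map hmp.measurable.aemeasurable hF.aestronglyMeasurable

theorem ae_norm_stickRest_le (hα : 0 < α) {ℓ : ℕ → ℕ} (hℓ : ∀ j, ℓ j = 0 ∨ ℓ j = 1) (J : ℕ) :
    ∀ᵐ v ∂propLaw α, ‖stickRest ℓ J v‖ ≤ 1 := by
  filter_upwards [ae_propLaw_mem hα] with v hv
  have := stickRest_mem hℓ hv J
  rw [Real.norm_of_nonneg this.1]
  exact this.2

/-- Each effective break contributes an independent factor 1 - v of mean α/(α+1); a thinned one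
contributes 1. -/
theorem integral_stickRest (hα : 0 < α) {ℓ : ℕ → ℕ} (hℓ : ∀ j, ℓ j = 0 ∨ ℓ j = 1) (J : ℕ) :
    ∫ v, stickRest ℓ J v ∂propLaw α = (α / (α + 1)) ^ ∑ j ∈ Finset.range J, ℓ j := by
  have := isProbabilityMeasure_betaMeasure_one hα
  induction J with
  | zero => simp [stickRest]
  | succ J ih =>
    rw [(integral_propLaw_eq hα J (measurable_stickRest ℓ (J + 1))
      (ae_norm_stickRest_le hα hℓ (J + 1))).2, Finset.sum_range_succ, pow_add, ← ih]
    simp only [stickRest_succ, stickRest_update, Function.update_self, integral_const_mul,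
      integral_mul_const]
    congr 1
    have h1 := integral_one_sub_pow_betaMeasure hα 1
    rcases hℓ J with h | h
    · simp [h]
    · simpa [h] using h1

theorem tendsto_sum_thinning {ℓ : ℕ → ℕ} (hℓ : ∑' j, (ℓ j : ℝ≥0∞) = ∞) :
    Filter.Tendsto (fun J => ∑ j ∈ Finset.range J, ℓ j) Filter.atTop Filter.atTop := by
  have h := ENNReal.tendsto_nat_tsum fun j => (ℓ j : ℝ≥0∞)
  rw [hℓ, ENNReal.tendsto_nhds_top_iff_nat] at h
  refine Filter.tendsto_atTop.2 fun m => (h m).mono fun J hJ => ?_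
  rw [← Nat.cast_sum] at hJ
  exact (Nat.cast_lt.1 hJ).le

theorem tendsto_integral_stickRest (hα : 0 < α) {ℓ : ℕ → ℕ} (hℓ : ∀ j, ℓ j = 0 ∨ ℓ j = 1)
    (htop : ∑' j, (ℓ j : ℝ≥0∞) = ∞) :
    Filter.Tendsto (fun J => ∫ v, stickRest ℓ J v ∂propLaw α) Filter.atTop (nhds 0) := by
  simp only [integral_stickRest hα hℓ]
  exact (tendsto_pow_atTop_nhds_zero_of_lt_one (by positivity)
    ((div_lt_one (by positivity)).2 (by linarith))).comp (tendsto_sum_thinning htop)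

theorem antitone_stickRest {ℓ : ℕ → ℕ} (hℓ : ∀ j, ℓ j = 0 ∨ ℓ j = 1) {v : ℕ → ℝ}
    (hv : ∀ j, v j ∈ Set.Icc (0 : ℝ) 1) : Antitone fun J => stickRest ℓ J v := by
  refine antitone_nat_of_succ_le fun J => ?_
  rw [stickRest_succ]
  exact mul_le_of_le_one_right (stickRest_mem hℓ hv J).1
    (one_sub_mem_Icc (mul_thin_mem_Icc (hv J) (hℓ J))).2

/-- The lengths decrease to their infimum, which is nonnegative and, by dominated convergence, has
integral 0. Hence the weights sum to 1. -/
theorem ae_tendsto_stickRest (hα : 0 < α) {ℓ : ℕ → ℕ} (hℓ : ∀ j, ℓ j = 0 ∨ ℓ j = 1)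
    (htop : ∑' j, (ℓ j : ℝ≥0∞) = ∞) :
    ∀ᵐ v ∂propLaw α, Filter.Tendsto (fun J => stickRest ℓ J v) Filter.atTop (nhds 0) := by
  have := isProbabilityMeasure_betaMeasure_one hα
  have hlim : ∀ᵐ v ∂propLaw α, Filter.Tendsto (fun J => stickRest ℓ J v) Filter.atTop
      (nhds (⨅ J, stickRest ℓ J v)) := by
    filter_upwards [ae_propLaw_mem hα] with v hv
    refine tendsto_atTop_ciInf (antitone_stickRest hℓ hv) ⟨0, ?_⟩
    rintro _ ⟨J, rfl⟩
    exact (stickRest_mem hℓ hv J).1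
  have h0 : ∀ᵐ v ∂propLaw α, 0 ≤ ⨅ J, stickRest ℓ J v := by
    filter_upwards [ae_propLaw_mem hα] with v hv
    exact le_ciInf fun J => (stickRest_mem hℓ hv J).1
  have hmeas : Measurable fun v => ⨅ J, stickRest ℓ J v :=
    Measurable.iInf fun J => measurable_stickRest ℓ J
  have hint := tendsto_integral_of_dominated_convergence (μ := propLaw α) (fun _ => (1 : ℝ))
    (F := fun J v => stickRest ℓ J v) (f := fun v => ⨅ J, stickRest ℓ J v)
    (fun J => (measurable_stickRest ℓ J).aestronglyMeasurable) (integrable_const _)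
    (ae_norm_stickRest_le hα hℓ) hlim
  have hzero := tendsto_nhds_unique hint (tendsto_integral_stickRest hα hℓ htop)
  have hinf : Integrable (fun v => ⨅ J, stickRest ℓ J v) (propLaw α) := by
    refine Integrable.of_bound hmeas.aestronglyMeasurable 1 ?_
    filter_upwards [ae_propLaw_mem hα, h0] with v hv hv0
    rw [Real.norm_of_nonneg hv0]
    refine (ciInf_le ⟨0, ?_⟩ 0).trans (stickRest_mem hℓ hv 0).2
    rintro _ ⟨J, rfl⟩
    exact (stickRest_mem hℓ hv J).1
  rw [integral_eq_zero_iff_of_nonneg_ae h0 hinf] at hzero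
  filter_upwards [hlim, hzero] with v hv hv0
  simpa [hv0] using hv

theorem ae_tsum_weight (hα : 0 < α) {ℓ : ℕ → ℕ} (hℓ : ∀ j, ℓ j = 0 ∨ ℓ j = 1)
    (htop : ∑' j, (ℓ j : ℝ≥0∞) = ∞) :
    ∀ᵐ v ∂propLaw α, ∑' j, ENNReal.ofReal (weight ℓ v j) = 1 := by
  filter_upwards [ae_propLaw_mem hα, ae_tendsto_stickRest hα hℓ htop] with v hv hlim
  have hsum : HasSum (weight ℓ v) 1 := by
    rw [hasSum_iff_tendsto_nat_of_nonneg fun j => (weight_mem hℓ hv j).1]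
    simp only [sum_weight]
    simpa using tendsto_const_nhds.sub hlim
  rw [← ENNReal.ofReal_tsum_of_nonneg (fun j => (weight_mem hℓ hv j).1) hsum.summable,
    hsum.tsum_eq, ENNReal.ofReal_one]

/-- The probability that the atom number `J` is observed in samples of sizes `a` and `b`. -/
noncomputable def atomProb (α : ℝ) (a b : ℕ) (ℓ ℓ' : ℕ → ℕ) (J : ℕ) : ℝ :=
  ∫ v, hitProb a b (weight ℓ v J) (weight ℓ' v J) ∂propLaw α

/-- The expectation of `remaining` after the first `J` breaks. -/
noncomputable def restProb (α : ℝ) (a b : ℕ) (ℓ ℓ' : ℕ → ℕ) (J : ℕ) : ℝ :=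
  ∫ v, remaining α a b (stickRest ℓ J v) (stickRest ℓ' J v) ∂propLaw α

section Bounds

variable {ℓ ℓ' : ℕ → ℕ} (hℓ : ∀ j, ℓ j = 0 ∨ ℓ j = 1) (hℓ' : ∀ j, ℓ' j = 0 ∨ ℓ' j = 1)
include hℓ hℓ'

theorem ae_norm_hitProb_le (hα : 0 < α) (a b J : ℕ) :
    ∀ᵐ v ∂propLaw α, ‖hitProb a b (weight ℓ v J) (weight ℓ' v J)‖ ≤ 1 := by
  filter_upwards [ae_propLaw_mem hα] with v hv
  have h1 := weight_mem hℓ hv J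
  have h2 := weight_mem hℓ' hv J
  rw [Real.norm_of_nonneg (hitProb_nonneg a b h1 h2)]
  exact hitProb_le_one a b h1 h2

theorem ae_norm_remaining_le (hα : 0 < α) (a b J : ℕ) :
    ∀ᵐ v ∂propLaw α, ‖remaining α a b (stickRest ℓ J v) (stickRest ℓ' J v)‖ ≤ a + b := by
  filter_upwards [ae_propLaw_mem hα] with v hv
  have h1 := stickRest_mem hℓ hv J
  have h2 := stickRest_mem hℓ' hv J
  have h := remaining_mem hα a b h1 h2
  rw [Real.norm_of_nonneg h.1]
  exact h.2.trans (add_le_add (mul_le_of_le_one_right (by positivity) h1.2)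
    (mul_le_of_le_one_right (by positivity) h2.2))

theorem integrable_hitProb (hα : 0 < α) (a b J : ℕ) :
    Integrable (fun v => hitProb a b (weight ℓ v J) (weight ℓ' v J)) (propLaw α) := by
  have := isProbabilityMeasure_betaMeasure_one hα
  exact Integrable.of_bound (measurable_hitProb a b (measurable_weight ℓ J)
    (measurable_weight ℓ' J)).aestronglyMeasurable 1 (ae_norm_hitProb_le hℓ hℓ' hα a b J)

theorem atomProb_nonneg (hα : 0 < α) (a b J : ℕ) : 0 ≤ atomProb α a b ℓ ℓ' J := by
  refine integral_nonneg_of_ae ?_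
  filter_upwards [ae_propLaw_mem hα] with v hv
  exact hitProb_nonneg a b (weight_mem hℓ hv J) (weight_mem hℓ' hv J)

theorem integrable_remaining (hα : 0 < α) (a b J : ℕ) :
    Integrable (fun v => remaining α a b (stickRest ℓ J v) (stickRest ℓ' J v)) (propLaw α) := by
  have := isProbabilityMeasure_betaMeasure_one hα
  exact Integrable.of_bound (measurable_remaining hα a b (measurable_stickRest ℓ J)
    (measurable_stickRest ℓ' J)).aestronglyMeasurable (a + b)
    (ae_norm_remaining_le hℓ hℓ' hα a b J)

/-- Resampling `v J` exposes the right side of the one-stick step inside the integral, ready for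
pointwise comparison with `remaining`. -/
theorem atomProb_add_restProb (hα : 0 < α) (a b J : ℕ) :
    Integrable (fun v =>
      ∫ x, hitProb a b (x * ℓ J * stickRest ℓ J v) (x * ℓ' J * stickRest ℓ' J v) ∂betaMeasure 1 α +
      ∫ x, remaining α a b (stickRest ℓ J v * (1 - x * ℓ J)) (stickRest ℓ' J v * (1 - x * ℓ' J))
        ∂betaMeasure 1 α) (propLaw α) ∧
    atomProb α a b ℓ ℓ' J + restProb α a b ℓ ℓ' (J + 1) = ∫ v,
      (∫ x, hitProb a b (x * ℓ J * stickRest ℓ J v) (x * ℓ' J * stickRest ℓ' J v) ∂betaMeasure 1 α +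
      ∫ x, remaining α a b (stickRest ℓ J v * (1 - x * ℓ J)) (stickRest ℓ' J v * (1 - x * ℓ' J))
        ∂betaMeasure 1 α) ∂propLaw α := by
  obtain ⟨h1, h2⟩ := integral_propLaw_eq hα J
    (measurable_hitProb a b (measurable_weight ℓ J) (measurable_weight ℓ' J))
    (ae_norm_hitProb_le hℓ hℓ' hα a b J)
  obtain ⟨h3, h4⟩ := integral_propLaw_eq hα J
    (measurable_remaining hα a b (measurable_stickRest ℓ (J + 1)) (measurable_stickRest ℓ' (J + 1)))
    (ae_norm_remaining_le hℓ hℓ' hα a b (J + 1))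
  simp only [weight_eq, stickRest_succ, stickRest_update, Function.update_self] at h1 h2 h3 h4
  refine ⟨h1.add h3, ?_⟩
  rw [integral_add h1 h3, ← h2, ← h4]
  simp only [atomProb, restProb, weight_eq, stickRest_succ]

theorem restProb_le_step (hα : 0 < α) (a b J : ℕ) :
    restProb α a b ℓ ℓ' J ≤ atomProb α a b ℓ ℓ' J + restProb α a b ℓ ℓ' (J + 1) := by
  obtain ⟨h1, h2⟩ := atomProb_add_restProb hℓ hℓ' hα a b J
  rw [h2]
  refine integral_mono_ae (integrable_remaining hℓ hℓ' hα a b J) h1 ?_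
  filter_upwards [ae_propLaw_mem hα] with v hv
  exact remaining_le_step hα a b (stickRest_mem hℓ hv J) (stickRest_mem hℓ' hv J) (hℓ J) (hℓ' J)

omit hℓ' in
theorem restProb_eq_step (hα : 0 < α) (a J : ℕ) :
    restProb α a 0 ℓ ℓ J = atomProb α a 0 ℓ ℓ J + restProb α a 0 ℓ ℓ (J + 1) := by
  rw [(atomProb_add_restProb hℓ hℓ hα a 0 J).2]
  refine integral_congr_ae ?_
  filter_upwards [ae_propLaw_mem hα] with v hv
  exact remaining_eq_step hα a (stickRest_mem hℓ hv J) (hℓ J)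

theorem restProb_mem (hα : 0 < α) (a b J : ℕ) :
    restProb α a b ℓ ℓ' J ∈ Set.Icc 0 (a * ∫ v, stickRest ℓ J v ∂propLaw α +
      b * ∫ v, stickRest ℓ' J v ∂propLaw α) := by
  have := isProbabilityMeasure_betaMeasure_one hα
  have hint : ∀ {l : ℕ → ℕ}, (∀ j, l j = 0 ∨ l j = 1) →
      Integrable (fun v => stickRest l J v) (propLaw α) := fun {l} hl =>
    Integrable.of_bound (measurable_stickRest l J).aestronglyMeasurable 1
      (ae_norm_stickRest_le hα hl J)
  have hmem : ∀ᵐ v ∂propLaw α, remaining α a b (stickRest ℓ J v) (stickRest ℓ' J v) ∈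
      Set.Icc 0 (a * stickRest ℓ J v + b * stickRest ℓ' J v) :=
    (ae_propLaw_mem hα).mono fun v hv =>
      remaining_mem hα a b (stickRest_mem hℓ hv J) (stickRest_mem hℓ' hv J)
  refine ⟨integral_nonneg_of_ae (hmem.mono fun v hv => hv.1), ?_⟩
  rw [← integral_const_mul, ← integral_const_mul,
    ← integral_add ((hint hℓ).const_mul _) ((hint hℓ').const_mul _)]
  exact integral_mono_ae (integrable_remaining hℓ hℓ' hα a b J)
    (((hint hℓ).const_mul _).add ((hint hℓ').const_mul _)) (hmem.mono fun v hv => hv.2)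

theorem tendsto_restProb (hα : 0 < α) (htop : ∑' j, (ℓ j : ℝ≥0∞) = ∞)
    (htop' : ∑' j, (ℓ' j : ℝ≥0∞) = ∞) (a b : ℕ) :
    Filter.Tendsto (restProb α a b ℓ ℓ') Filter.atTop (nhds 0) := by
  refine squeeze_zero (fun J => (restProb_mem hℓ hℓ' hα a b J).1)
    (fun J => (restProb_mem hℓ hℓ' hα a b J).2) ?_
  simpa using ((tendsto_integral_stickRest hα hℓ htop).const_mul (a : ℝ)).add
    ((tendsto_integral_stickRest hα hℓ' htop').const_mul (b : ℝ))

omit hℓ hℓ' in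
theorem restProb_zero (hα : 0 < α) (a b : ℕ) :
    restProb α a b ℓ ℓ' 0 = ∑ i ∈ Finset.Icc 1 (a + b), α / (α + (i : ℝ) - 1) := by
  have := isProbabilityMeasure_betaMeasure_one hα
  simp [restProb, stickRest, remaining_one_one hα]

omit hℓ' in
-- Exact telescoping from the potential at full length; the sum does not depend on the thinning
-- sequence.
theorem hasSum_atomProb_self (hα : 0 < α) (htop : ∑' j, (ℓ j : ℝ≥0∞) = ∞) (a : ℕ) :
    HasSum (atomProb α a 0 ℓ ℓ) (∑ i ∈ Finset.Icc 1 a, α / (α + (i : ℝ) - 1)) := by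
  have h : ∀ J, ∑ j ∈ Finset.range J, atomProb α a 0 ℓ ℓ j =
      (∑ i ∈ Finset.Icc 1 a, α / (α + (i : ℝ) - 1)) - restProb α a 0 ℓ ℓ J := fun J => by
    induction J with
    | zero => simp [restProb_zero hα]
    | succ J ih => rw [Finset.sum_range_succ, ih, restProb_eq_step hℓ hα a J]; ring
  rw [hasSum_iff_tendsto_nat_of_nonneg (atomProb_nonneg hℓ hℓ hα a 0)]
  simp only [h]
  simpa using tendsto_const_nhds.sub (tendsto_restProb hℓ hℓ hα htop htop a 0)

theorem atomProb_le_add (hα : 0 < α) (a b J : ℕ) :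
    atomProb α a b ℓ ℓ' J ≤ atomProb α a 0 ℓ ℓ J + atomProb α b 0 ℓ' ℓ' J := by
  have h1 := integrable_hitProb hℓ hℓ hα a 0 J
  have h2 := integrable_hitProb hℓ' hℓ' hα b 0 J
  unfold atomProb
  rw [← integral_add h1 h2]
  refine integral_mono_ae (integrable_hitProb hℓ hℓ' hα a b J) (h1.add h2) ?_
  filter_upwards [ae_propLaw_mem hα] with v hv
  refine (hitProb_le_add a b (weight_mem hℓ hv J) (weight_mem hℓ' hv J)).trans_eq ?_
  simp [hitProb]

/-- The expected number of observed atoms, between that in a common Dirichlet process and that in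
two unrelated ones. -/
theorem summable_atomProb_and_bounds (hα : 0 < α) (htop : ∑' j, (ℓ j : ℝ≥0∞) = ∞)
    (htop' : ∑' j, (ℓ' j : ℝ≥0∞) = ∞) (a b : ℕ) :
    Summable (atomProb α a b ℓ ℓ') ∧
    ∑ i ∈ Finset.Icc 1 (a + b), α / (α + (i : ℝ) - 1) ≤ ∑' J, atomProb α a b ℓ ℓ' J ∧
    ∑' J, atomProb α a b ℓ ℓ' J ≤ ∑ i ∈ Finset.Icc 1 a, α / (α + (i : ℝ) - 1) +
      ∑ i ∈ Finset.Icc 1 b, α / (α + (i : ℝ) - 1) := by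
  have hsum := (hasSum_atomProb_self hℓ hα htop a).add (hasSum_atomProb_self hℓ' hα htop' b)
  have hs : Summable (atomProb α a b ℓ ℓ') := Summable.of_nonneg_of_le
    (atomProb_nonneg hℓ hℓ' hα a b) (atomProb_le_add hℓ hℓ' hα a b) hsum.summable
  refine ⟨hs, ?_, ?_⟩
  -- Telescoping inequality; the potential term disappears in the limit.
  · have h : ∀ J, ∑ i ∈ Finset.Icc 1 (a + b), α / (α + (i : ℝ) - 1) ≤
        ∑ j ∈ Finset.range J, atomProb α a b ℓ ℓ' j + restProb α a b ℓ ℓ' J := fun J => by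
      induction J with
      | zero => simp [restProb_zero hα]
      | succ J ih =>
        rw [Finset.sum_range_succ]
        linarith [restProb_le_step hℓ hℓ' hα a b J]
    have hlim := hs.hasSum.tendsto_sum_nat.add (tendsto_restProb hℓ hℓ' hα htop htop' a b)
    rw [add_zero] at hlim
    exact ge_of_tendsto' hlim h
  · rw [← hsum.tsum_eq]
    exact hs.tsum_le_tsum (atomProb_le_add hℓ hℓ' hα a b) hsum.summable

end Bounds
end Sticks

/-! ### Random vectors as mixtures of product measures. -/

section Mixture

variable {X Θ I : Type*} [MeasurableSpace X] [MeasurableSpace Θ] [Fintype I]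

theorem measurable_measure_pi {Q : I → X → Measure Θ} (hQ : ∀ i, Measurable (Q i))
    [∀ i x, IsProbabilityMeasure (Q i x)] : Measurable fun x => Measure.pi fun i => Q i x := by
  refine Measurable.measure_of_isPiSystem_of_isProbabilityMeasure generateFrom_pi.symm
    isPiSystem_pi ?_
  rintro _ ⟨A, hA, rfl⟩
  simp only [Measure.pi_pi]
  exact Finset.measurable_prod _ fun i _ =>
    (Measure.measurable_coe (hA i (Set.mem_univ i))).comp (hQ i)

theorem aemeasurable_measure_pi [Nonempty Θ] {Q : I → X → Measure Θ}
    (hQ : ∀ i, Measurable (Q i)) {ρ : Measure X}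
    (hρ : ∀ᵐ x ∂ρ, ∀ i, IsProbabilityMeasure (Q i x)) :
    AEMeasurable (fun x => Measure.pi fun i => Q i x) ρ := by
  classical
  obtain ⟨t⟩ := ‹Nonempty Θ›
  -- The kernels are probability measures only almost everywhere; a Dirac mass is substituted on the
  -- exceptional set.
  let q : I → X → Measure Θ := fun i x =>
    if Q i x Set.univ = 1 then Q i x else Measure.dirac t
  have hq : ∀ i, Measurable (q i) := fun i =>
    Measurable.ite (measurableSet_eq_fun ((Measure.measurable_coe MeasurableSet.univ).comp (hQ i))
      measurable_const) (hQ i) measurable_const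
  have hprob : ∀ i x, IsProbabilityMeasure (q i x) := fun i x => by
    by_cases h : Q i x Set.univ = 1
    · simpa only [q, if_pos h] using IsProbabilityMeasure.mk h
    · simp only [q, if_neg h]
      infer_instance
  refine ⟨fun x => Measure.pi fun i => q i x, measurable_measure_pi hq, ?_⟩
  filter_upwards [hρ] with x hx
  congr 1
  funext i
  have := hx i
  simp only [q, if_pos (measure_univ (μ := Q i x))]

/-- A random vector whose law agrees on rectangles with a mixture of product measures. -/
theorem map_eq_bind_pi {Ω : Type*} [MeasurableSpace Ω] [Nonempty Θ] {μ : Measure Ω}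
    [IsProbabilityMeasure μ] {ρ : Measure X} {Q : I → X → Measure Θ}
    (hQ : ∀ i, Measurable (Q i)) (hρ : ∀ᵐ x ∂ρ, ∀ i, IsProbabilityMeasure (Q i x))
    {Y : Ω → I → Θ} (hY : Measurable Y)
    (h : ∀ A : I → Set Θ, (∀ i, MeasurableSet (A i)) →
      μ {ω | ∀ i, Y ω i ∈ A i} = ∫⁻ x, ∏ i, Q i x (A i) ∂ρ) :
    μ.map Y = ρ.bind fun x => Measure.pi fun i => Q i x := by
  have hm := aemeasurable_measure_pi hQ hρ
  have hrect : ∀ A : I → Set Θ, (∀ i, MeasurableSet (A i)) →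
      μ.map Y (Set.univ.pi A) = (ρ.bind fun x => Measure.pi fun i => Q i x) (Set.univ.pi A) := by
    intro A hA
    have hAm : MeasurableSet (Set.univ.pi A) := MeasurableSet.univ_pi hA
    rw [Measure.map_apply hY hAm, Measure.bind_apply hAm hm]
    have : Y ⁻¹' Set.univ.pi A = {ω | ∀ i, Y ω i ∈ A i} := by ext; simp
    rw [this, h A hA]
    refine lintegral_congr_ae ?_
    filter_upwards [hρ] with x hx
    rw [Measure.pi_pi]
  have := Measure.isProbabilityMeasure_map (μ := μ) hY.aemeasurable
  refine ext_of_generate_finite _ generateFrom_pi.symm isPiSystem_pi ?_ ?_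
  · rintro _ ⟨A, hA, rfl⟩
    exact hrect A fun i => hA i (Set.mem_univ i)
  · simpa using hrect (fun _ => Set.univ) fun _ => MeasurableSet.univ

end Mixture

/-! ### Counting distinct values through the atoms that are hit. -/

section Distinct

variable {Θ I : Type*} [MeasurableSpace Θ] [Fintype I]

/-- The count depends only on the equality pattern of the vector, which takes finitely many values
and is measurable because the diagonal is. -/
theorem measurable_ncard_range [MeasurableEq Θ] :
    Measurable fun z : I → Θ => (Set.range z).ncard := by
  have h : (fun z : I → Θ => (Set.range z).ncard) =
      (fun r : I → I → Prop => Nat.card (Quot r)) ∘ fun z i k => z i = z k := by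
    funext z
    rw [Function.comp_apply, ← Nat.card_coe_set_eq]
    exact Nat.card_congr (Setoid.quotientKerEquivRange z).symm
  rw [h]
  refine (measurable_of_finite _).comp ?_
  refine measurable_pi_lambda _ fun i => measurable_pi_lambda _ fun k => ?_
  exact measurableSet_setOfPred.1
    (measurableSet_eq_fun (measurable_pi_apply i) (measurable_pi_apply k))

omit [MeasurableSpace Θ] in
theorem ncard_range_eq_tsum {θ : ℕ → Θ} (hθ : Function.Injective θ) {z : I → Θ}
    (hz : ∀ i, z i ∈ Set.range θ) :
    ((Set.range z).ncard : ℝ≥0∞) =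
      ∑' j, {z : I → Θ | ∃ i, z i = θ j}.indicator (fun _ => 1) z := by
  classical
  have hfin : (Set.range z).Finite := Set.finite_range z
  have h1 : Set.range z = θ '' {j | ∃ i, z i = θ j} := by
    ext t
    constructor
    · rintro ⟨i, rfl⟩
      obtain ⟨j, hj⟩ := hz i
      exact ⟨j, ⟨i, hj.symm⟩, hj⟩
    · rintro ⟨j, ⟨i, hi⟩, rfl⟩
      exact ⟨i, hi⟩
  have hfin' : {j | ∃ i, z i = θ j}.Finite :=
    Set.Finite.of_finite_image (h1 ▸ hfin) hθ.injOn
  rw [h1, Set.ncard_image_of_injective _ hθ, Set.ncard_eq_toFinset_card _ hfin',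
    tsum_eq_sum (s := hfin'.toFinset)]
  · rw [Finset.sum_congr rfl (g := fun _ => 1)]
    · simp
    · intro j hj
      rw [Set.Finite.mem_toFinset] at hj
      exact Set.indicator_of_mem (s := {z : I → Θ | ∃ i, z i = θ j}) hj _
  · intro j hj
    rw [Set.Finite.mem_toFinset] at hj
    exact Set.indicator_of_notMem (s := {z : I → Θ | ∃ i, z i = θ j}) hj _

/-- The expected number of distinct values in independent draws from discrete probability measures
with common atoms. -/
theorem lintegral_ncard_range_pi [MeasurableSingletonClass Θ] {θ : ℕ → Θ}
    (hθ : Function.Injective θ) (Q : I → Measure Θ) [∀ i, IsProbabilityMeasure (Q i)]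
    (hQ : ∀ i, Q i (Set.range θ)ᶜ = 0) :
    ∫⁻ z, ((Set.range z).ncard : ℝ≥0∞) ∂Measure.pi Q =
      ∑' j, (1 - ∏ i, (1 - Q i {θ j})) := by
  have hae : ∀ᵐ z ∂Measure.pi Q, ∀ i, z i ∈ Set.range θ := by
    rw [ae_all_iff]
    intro i
    exact Measure.tendsto_eval_ae_ae.eventually (show ∀ᵐ t ∂Q i, t ∈ Set.range θ from hQ i)
  have hcompl : ∀ j, {z : I → Θ | ∃ i, z i = θ j} = (Set.univ.pi fun _ => {θ j}ᶜ)ᶜ := fun j => by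
    ext z
    simp
  have hpi : ∀ j, MeasurableSet (Set.univ.pi fun _ : I => ({θ j} : Set Θ)ᶜ) := fun j =>
    MeasurableSet.univ_pi fun _ => (measurableSet_singleton _).compl
  rw [lintegral_congr_ae (hae.mono fun z hz => ncard_range_eq_tsum hθ hz),
    lintegral_tsum fun j => (measurable_const.indicator
      (hcompl j ▸ (hpi j).compl)).aemeasurable]
  refine tsum_congr fun j => ?_
  rw [hcompl j, lintegral_indicator (hpi j).compl, setLIntegral_one,
    prob_compl_eq_one_sub (hpi j), Measure.pi_pi]
  simp only [prob_compl_eq_one_sub (measurableSet_singleton _)]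

end Distinct

/-! ### Masses and atoms of the stick-breaking measures. -/

section Stick

variable {Θ : Type*} [MeasurableSpace Θ]

theorem stickMeasure_univ (ℓ : ℕ → ℕ) (v : ℕ → ℝ) (θ : ℕ → Θ) :
    stickMeasure ℓ v θ Set.univ = ∑' j, ENNReal.ofReal (weight ℓ v j) := by
  simp [stickMeasure, Measure.sum_apply]

theorem stickMeasure_compl_range [MeasurableSingletonClass Θ] (ℓ : ℕ → ℕ) (v : ℕ → ℝ)
    (θ : ℕ → Θ) : stickMeasure ℓ v θ (Set.range θ)ᶜ = 0 := by
  have hm : MeasurableSet (Set.range θ)ᶜ := (Set.countable_range θ).measurableSet.compl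
  rw [stickMeasure, Measure.sum_apply _ hm]
  simp [hm]

theorem stickMeasure_singleton [MeasurableSingletonClass Θ] (ℓ : ℕ → ℕ) (v : ℕ → ℝ)
    {θ : ℕ → Θ} (hθ : Function.Injective θ) (j : ℕ) :
    stickMeasure ℓ v θ {θ j} = ENNReal.ofReal (weight ℓ v j) := by
  rw [stickMeasure, Measure.sum_apply _ (measurableSet_singleton _), tsum_eq_single j]
  · simp
  · intro k hk
    simp [hθ.ne hk]

theorem ae_injective_infinitePi [MeasurableEq Θ] (P₀ : Measure Θ) [IsProbabilityMeasure P₀]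
    (hP₀ : ∀ t, P₀ {t} = 0) :
    ∀ᵐ θ ∂Measure.infinitePi fun _ : ℕ => P₀, Function.Injective θ := by
  have h : ∀ i j : ℕ, i ≠ j → ∀ᵐ θ ∂Measure.infinitePi fun _ : ℕ => P₀, θ i ≠ θ j := by
    intro i j hij
    have hm : MeasurableSet {θ : ℕ → Θ | θ i ≠ θ j} :=
      (measurableSet_eq_fun (measurable_pi_apply i) (measurable_pi_apply j)).compl
    -- Resample θ_j: given θ_i, the fresh copy avoids it almost surely since `P₀` has no point
    -- masses.
    rw [← (measurePreserving_update_infinitePi P₀ j).map_eq,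
      ae_map_iff (measurePreserving_update_infinitePi P₀ j).measurable.aemeasurable hm]
    simp only [Function.update_of_ne hij, Function.update_self]
    have hm' : MeasurableSet {z : (ℕ → Θ) × Θ | z.1 i = z.2} :=
      measurableSet_eq_fun ((measurable_pi_apply i).comp measurable_fst) measurable_snd
    have := (Measure.measure_prod_null (μ := Measure.infinitePi fun _ : ℕ => P₀) (ν := P₀) hm').2
      (Filter.Eventually.of_forall fun θ => by
        have : Prod.mk θ ⁻¹' {z : (ℕ → Θ) × Θ | z.1 i = z.2} = {θ i} := by
          ext t
          simp [eq_comm]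
        simp [this, hP₀])
    rw [ae_iff]
    simpa using this
  have h' : ∀ᵐ θ ∂Measure.infinitePi fun _ : ℕ => P₀, ∀ i j : ℕ, i ≠ j → θ i ≠ θ j := by
    simp only [ae_all_iff]
    exact h
  filter_upwards [h'] with θ hθ i j hij
  by_contra hne
  exact hθ i j hne hij

variable {ι : Type*} {α : ℝ}

theorem isProbabilityMeasure_stickLaw (hα : 0 < α) (P₀ : Measure Θ) [IsProbabilityMeasure P₀] :
    IsProbabilityMeasure (stickLaw α P₀) := by
  have := isProbabilityMeasure_betaMeasure_one hα
  unfold stickLaw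
  infer_instance

theorem ae_stickLaw_fst (hα : 0 < α) (P₀ : Measure Θ) [IsProbabilityMeasure P₀]
    {p : (ℕ → ℝ) → Prop} (h : ∀ᵐ v ∂propLaw α, p v) : ∀ᵐ x ∂stickLaw α P₀, p x.1 := by
  have := isProbabilityMeasure_betaMeasure_one hα
  exact Measure.quasiMeasurePreserving_fst.ae h

theorem ae_stickLaw_snd (hα : 0 < α) (P₀ : Measure Θ) [IsProbabilityMeasure P₀]
    {p : (ℕ → Θ) → Prop} (h : ∀ᵐ θ ∂Measure.infinitePi fun _ : ℕ => P₀, p θ) :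
    ∀ᵐ x ∂stickLaw α P₀, p x.2 := by
  have := isProbabilityMeasure_betaMeasure_one hα
  exact Measure.quasiMeasurePreserving_snd.ae h

theorem ae_isProbabilityMeasure_stickMeasure [Countable ι] (hα : 0 < α) (P₀ : Measure Θ)
    [IsProbabilityMeasure P₀] {ℓ : ι → ℕ → ℕ} (hℓ : IsThinning ℓ) :
    ∀ᵐ x ∂stickLaw α P₀, ∀ g, IsProbabilityMeasure (stickMeasure (ℓ g) x.1 x.2) := by
  rw [ae_all_iff]
  intro g
  filter_upwards [ae_stickLaw_fst hα P₀
    (ae_tsum_weight hα (hℓ.zero_or_one g) (hℓ.tsum_eq_top g))] with x hx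
  exact ⟨(stickMeasure_univ _ _ _).trans hx⟩

end Stick

/-! ### From conditionally independent samples to the sum over atoms. -/

section Sample

variable {Ω Θ ι : Type*} [MeasurableSpace Ω] [MeasurableSpace Θ] [Fintype ι]
  {μ : Measure Ω} [IsProbabilityMeasure μ] {α : ℝ} {P₀ : Measure Θ} [IsProbabilityMeasure P₀]
  {ℓ : ι → ℕ → ℕ} {p : Ω → ι → Measure Θ} {n : ι → ℕ} {y : (g : ι) → Fin (n g) → Ω → Θ}

/-- Integrating the conditional probability and transporting along the law of `p` moves everything
to the canonical `v` and `θ`. The passage from real to extended nonnegative values uses that the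
products are at most 1 almost surely. -/
theorem measure_rectangle_of_isSample (hα : 0 < α) (hℓ : IsThinning ℓ)
    (hp : IsThinnedDDP μ α P₀ ℓ p) (hy : IsSample μ p y) (A : (g : ι) → Fin (n g) → Set Θ)
    (hA : ∀ g i, MeasurableSet (A g i)) :
    μ {ω | ∀ g i, y g i ω ∈ A g i} =
      ∫⁻ x, ∏ g, ∏ i, stickMeasure (ℓ g) x.1 x.2 (A g i) ∂stickLaw α P₀ := by
  have := isProbabilityMeasure_stickLaw hα P₀
  have hF : Measurable fun (x : (ℕ → ℝ) × (ℕ → Θ)) (g : ι) => stickMeasure (ℓ g) x.1 x.2 :=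
    measurable_pi_lambda _ fun g => measurable_stickMeasure (ℓ g)
  have hE : MeasurableSet {ω | ∀ g i, y g i ω ∈ A g i} := by
    simp only [Set.ofPred_forall]
    exact MeasurableSet.iInter fun g => MeasurableSet.iInter fun i => hy.measurable g i (hA g i)
  have hG : Measurable fun m : ι → Measure Θ => ∏ g, ∏ i, (m g (A g i)).toReal :=
    Finset.measurable_prod _ fun g _ => Finset.measurable_prod _ fun i _ =>
      ((Measure.measurable_coe (hA g i)).comp (measurable_pi_apply g)).ennreal_toReal
  have h1 : μ.real {ω | ∀ g i, y g i ω ∈ A g i} =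
      ∫ x, ∏ g, ∏ i, (stickMeasure (ℓ g) x.1 x.2 (A g i)).toReal ∂stickLaw α P₀ := by
    calc μ.real {ω | ∀ g i, y g i ω ∈ A g i}
        = ∫ ω, (μ⟦{ω | ∀ g i, y g i ω ∈ A g i} | MeasurableSpace.comap p inferInstance⟧) ω ∂μ := by
          rw [integral_condExp hp.measurable.comap_le, integral_indicator_const _ hE]
          simp
      _ = ∫ ω, ∏ g, ∏ i, (p ω g (A g i)).toReal ∂μ := integral_congr_ae (hy.condProb A hA)
      _ = ∫ m, ∏ g, ∏ i, (m g (A g i)).toReal ∂(μ.map p) :=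
          (integral_map hp.measurable.aemeasurable hG.aestronglyMeasurable).symm
      _ = _ := by
          rw [hp.map_eq, thinnedDDPLaw, integral_map hF.aemeasurable hG.aestronglyMeasurable]
  have h2 : ∫ x, ∏ g, ∏ i, (stickMeasure (ℓ g) x.1 x.2 (A g i)).toReal ∂stickLaw α P₀ =
      (∫⁻ x, ∏ g, ∏ i, stickMeasure (ℓ g) x.1 x.2 (A g i) ∂stickLaw α P₀).toReal := by
    have hm : Measurable fun x : (ℕ → ℝ) × (ℕ → Θ) =>
        ∏ g, ∏ i, stickMeasure (ℓ g) x.1 x.2 (A g i) :=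
      Finset.measurable_prod _ fun g _ => Finset.measurable_prod _ fun i _ =>
        (Measure.measurable_coe (hA g i)).comp (measurable_stickMeasure (ℓ g))
    rw [← integral_toReal hm.aemeasurable]
    · simp only [ENNReal.toReal_prod]
    · filter_upwards [ae_isProbabilityMeasure_stickMeasure hα P₀ hℓ] with x hx
      exact ENNReal.prod_lt_top fun g _ => ENNReal.prod_lt_top fun i _ => measure_lt_top _ _
  have hle : ∫⁻ x, ∏ g, ∏ i, stickMeasure (ℓ g) x.1 x.2 (A g i) ∂stickLaw α P₀ ≤ 1 := by
    calc _ ≤ ∫⁻ _, 1 ∂stickLaw α P₀ := by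
          refine lintegral_mono_ae ?_
          filter_upwards [ae_isProbabilityMeasure_stickMeasure hα P₀ hℓ] with x hx
          exact Finset.prod_le_one' fun g _ => Finset.prod_le_one' fun i _ => prob_le_one
      _ = 1 := by simp
  rw [← ENNReal.toReal_eq_toReal_iff' (measure_ne_top _ _) (hle.trans_lt ENNReal.one_lt_top).ne,
    ← h2, ← h1]
  rfl

omit [MeasurableSpace Ω] [MeasurableSpace Θ] [Fintype ι] in
theorem numDistinct_eq (ω : Ω) :
    numDistinct y ω = (Set.range fun i : (Σ g, Fin (n g)) => y i.1 i.2 ω).ncard := by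
  unfold numDistinct
  congr 1
  ext t
  simp

theorem lintegral_numDistinct [MeasurableEq Θ] (hα : 0 < α) (hP₀ : ∀ t, P₀ {t} = 0)
    (hℓ : IsThinning ℓ) (hp : IsThinnedDDP μ α P₀ ℓ p) (hy : IsSample μ p y) :
    ∫⁻ ω, (numDistinct y ω : ℝ≥0∞) ∂μ = ∑' j, ENNReal.ofReal
      (∫ v, (1 - ∏ g, (1 - weight (ℓ g) v j) ^ n g) ∂propLaw α) := by
  have := isProbabilityMeasure_betaMeasure_one hα
  have := isProbabilityMeasure_stickLaw hα P₀
  have : MeasurableSingletonClass Θ := inferInstance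
  have : Nonempty Θ := P₀.nonempty_of_neZero
  let Q : (Σ g, Fin (n g)) → (ℕ → ℝ) × (ℕ → Θ) → Measure Θ :=
    fun i x => stickMeasure (ℓ i.1) x.1 x.2
  have hQ : ∀ i, Measurable (Q i) := fun i => measurable_stickMeasure (ℓ i.1)
  have hprob : ∀ᵐ x ∂stickLaw α P₀, ∀ i, IsProbabilityMeasure (Q i x) :=
    (ae_isProbabilityMeasure_stickMeasure hα P₀ hℓ).mono fun x hx i => hx i.1
  have hY : Measurable fun ω (i : Σ g, Fin (n g)) => y i.1 i.2 ω :=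
    measurable_pi_lambda _ fun i => hy.measurable i.1 i.2
  have hlaw := map_eq_bind_pi (μ := μ) hQ hprob hY fun A hA => by
    have h := measure_rectangle_of_isSample hα hℓ hp hy (fun g i => A ⟨g, i⟩) fun g i => hA _
    simpa only [Sigma.forall, Fintype.prod_sigma, Q] using h
  have hcard : Measurable fun z : (Σ g, Fin (n g)) → Θ => ((Set.range z).ncard : ℝ≥0∞) :=
    (measurable_of_countable (fun k : ℕ => (k : ℝ≥0∞))).comp measurable_ncard_range
  have hw : ∀ j, Measurable fun v => 1 - ∏ g, (1 - weight (ℓ g) v j) ^ n g := fun j =>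
    measurable_const.sub (Finset.measurable_prod _ fun g _ =>
      (measurable_const.sub (measurable_weight (ℓ g) j)).pow_const _)
  have hmem : ∀ᵐ v ∂propLaw α, ∀ j, 1 - ∏ g, (1 - weight (ℓ g) v j) ^ n g ∈ Set.Icc (0 : ℝ) 1 := by
    filter_upwards [ae_propLaw_mem hα] with v hv j
    have hg : ∀ g, 1 - weight (ℓ g) v j ∈ Set.Icc (0 : ℝ) 1 := fun g =>
      one_sub_mem_Icc (weight_mem (hℓ.zero_or_one g) hv j)
    exact one_sub_mem_Icc ⟨Finset.prod_nonneg fun g _ => pow_nonneg (hg g).1 _,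
      Finset.prod_le_one (fun g _ => pow_nonneg (hg g).1 _) fun g _ =>
        pow_le_one₀ (hg g).1 (hg g).2⟩
  calc ∫⁻ ω, (numDistinct y ω : ℝ≥0∞) ∂μ
      = ∫⁻ z, ((Set.range z).ncard : ℝ≥0∞) ∂μ.map fun ω (i : Σ g, Fin (n g)) => y i.1 i.2 ω := by
        rw [lintegral_map hcard hY]
        simp only [numDistinct_eq]
    _ = ∫⁻ x, ∫⁻ z, ((Set.range z).ncard : ℝ≥0∞) ∂(Measure.pi fun i => Q i x) ∂stickLaw α P₀ := by
        rw [hlaw, Measure.lintegral_bind (aemeasurable_measure_pi hQ hprob) hcard.aemeasurable]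
    _ = ∫⁻ x, ∑' j, ENNReal.ofReal (1 - ∏ g, (1 - weight (ℓ g) x.1 j) ^ n g) ∂stickLaw α P₀ := by
        refine lintegral_congr_ae ?_
        filter_upwards [hprob, ae_stickLaw_fst hα P₀ (ae_propLaw_mem hα),
          ae_stickLaw_snd hα P₀ (ae_injective_infinitePi P₀ hP₀)] with x hx hv hθ
        rw [lintegral_ncard_range_pi hθ _ fun i => stickMeasure_compl_range _ _ _]
        refine tsum_congr fun j => ?_
        have hg : ∀ g, 0 ≤ 1 - weight (ℓ g) x.1 j := fun g =>
          (one_sub_mem_Icc (weight_mem (hℓ.zero_or_one g) hv j)).1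
        simp only [stickMeasure_singleton _ _ hθ, Fintype.prod_sigma, Finset.prod_const,
          Finset.card_univ, Fintype.card_fin]
        rw [ENNReal.ofReal_sub _ (Finset.prod_nonneg fun g _ => pow_nonneg (hg g) _),
          ENNReal.ofReal_one, ENNReal.ofReal_prod_of_nonneg fun g _ => pow_nonneg (hg g) _]
        congr 1
        refine Finset.prod_congr rfl fun g _ => ?_
        rw [ENNReal.ofReal_pow (hg g),
          ENNReal.ofReal_sub _ (weight_mem (hℓ.zero_or_one g) hv j).1, ENNReal.ofReal_one]
    _ = ∑' j, ∫⁻ x, ENNReal.ofReal (1 - ∏ g, (1 - weight (ℓ g) x.1 j) ^ n g) ∂stickLaw α P₀ :=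
        lintegral_tsum fun j => ((hw j).comp measurable_fst).ennreal_ofReal.aemeasurable
    _ = _ := by
        refine tsum_congr fun j => ?_
        have hfst : (stickLaw α P₀).map Prod.fst = propLaw α := by
          rw [stickLaw, Measure.map_fst_prod]
          simp
        rw [ofReal_integral_eq_lintegral_ofReal, ← hfst,
          lintegral_map (hw j).ennreal_ofReal measurable_fst]
        · refine Integrable.of_bound (hw j).aestronglyMeasurable 1 (hmem.mono fun v hv => ?_)
          rw [Real.norm_of_nonneg (hv j).1]
          exact (hv j).2
        · exact hmem.mono fun v hv => (hv j).1

theorem integrable_numDistinct [MeasurableEq Θ] (hy : ∀ g i, Measurable (y g i)) :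
    Integrable (fun ω => (numDistinct y ω : ℝ)) μ := by
  have hY : Measurable fun ω (i : Σ g, Fin (n g)) => y i.1 i.2 ω :=
    measurable_pi_lambda _ fun i => hy i.1 i.2
  have hm : Measurable fun ω => (numDistinct y ω : ℝ) := by
    simp only [numDistinct_eq]
    exact (measurable_of_countable (fun k : ℕ => (k : ℝ))).comp (measurable_ncard_range.comp hY)
  refine Integrable.of_bound hm.aestronglyMeasurable (Fintype.card (Σ g, Fin (n g)))
    (Filter.Eventually.of_forall fun ω => ?_)
  rw [Real.norm_of_nonneg (Nat.cast_nonneg _), numDistinct_eq, ← Set.image_univ]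
  have h := Set.ncard_image_le (f := fun i : (Σ g, Fin (n g)) => y i.1 i.2 ω) Set.finite_univ
  rw [Set.ncard_univ, Nat.card_eq_fintype_card] at h
  exact_mod_cast h

/-- The summands are left as a free sequence `t` so that one statement serves both the pair and the
single Dirichlet process. -/
theorem integral_numDistinct [MeasurableEq Θ] (hα : 0 < α) (hP₀ : ∀ t, P₀ {t} = 0)
    (hℓ : IsThinning ℓ) (hp : IsThinnedDDP μ α P₀ ℓ p) (hy : IsSample μ p y) {t : ℕ → ℝ}
    (ht : ∀ j, ∫ v, (1 - ∏ g, (1 - weight (ℓ g) v j) ^ n g) ∂propLaw α = t j)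
    (ht0 : ∀ j, 0 ≤ t j) (hsum : Summable t) :
    ∫ ω, (numDistinct y ω : ℝ) ∂μ = ∑' j, t j := by
  rw [integral_eq_lintegral_of_nonneg_ae (Filter.Eventually.of_forall fun ω => Nat.cast_nonneg _)
    (integrable_numDistinct hy.measurable).aestronglyMeasurable]
  simp only [ENNReal.ofReal_natCast]
  rw [lintegral_numDistinct hα hP₀ hℓ hp hy]
  simp only [ht]
  rw [← ENNReal.ofReal_tsum_of_nonneg ht0 hsum, ENNReal.toReal_ofReal (tsum_nonneg ht0)]

end Sample

theorem IsDirichletProcess.isThinnedDDP {Ω Θ : Type*} [MeasurableSpace Ω] [MeasurableSpace Θ]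
    {μ : Measure Ω} {α : ℝ} {P₀ : Measure Θ} {q : Ω → Measure Θ}
    (hq : IsDirichletProcess μ α P₀ q) :
    IsThinnedDDP μ α P₀ (fun (_ : Unit) _ => 1) fun ω _ => q ω := by
  have hc : Measurable fun (m : Measure Θ) (_ : Unit) => m :=
    measurable_pi_lambda _ fun _ => measurable_id
  have hm := hq.measurable
  refine ⟨hc.comp hm, ?_⟩
  have h := congrArg (Measure.map fun (m : Measure Θ) (_ : Unit) => m) hq.map_eq
  rw [Measure.map_map hc hm, dirichletProcessLaw,
    Measure.map_map hc (measurable_stickMeasure _)] at h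
  exact h

end ThinnedDDP

/-! ### The bounds, and the single Dirichlet process as an unthinned one-component case. -/

theorem proposition2 {Ω Θ : Type*} [MeasurableSpace Ω] [MeasurableSpace Θ] [MeasurableEq Θ]
    (μ : Measure Ω) [IsProbabilityMeasure μ]
    (α : ℝ) (hα : 0 < α) (P₀ : Measure Θ) [IsProbabilityMeasure P₀] (hP₀ : ∀ t, P₀ {t} = 0)
    (ℓ : Fin 2 → ℕ → ℕ) (hℓ : ThinnedDDP.IsThinning ℓ)
    (p : Ω → Fin 2 → Measure Θ) (hp : ThinnedDDP.IsThinnedDDP μ α P₀ ℓ p)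
    (n : Fin 2 → ℕ) (y : (g : Fin 2) → Fin (n g) → Ω → Θ) (hy : ThinnedDDP.IsSample μ p y) :
    -- the expected number of distinct values in a sample of size `m` from a single DP
    (∀ {Ω' : Type*} [MeasurableSpace Ω'] (ν : Measure Ω') [IsProbabilityMeasure ν]
      (q : Ω' → Measure Θ) (m : ℕ) (x : Fin m → Ω' → Θ),
      ThinnedDDP.IsDirichletProcess ν α P₀ q →
      ThinnedDDP.IsSample ν (fun ω (_ : Unit) => q ω) (fun _ : Unit => x) →
      Integrable (fun ω => (ThinnedDDP.numDistinct (fun _ : Unit => x) ω : ℝ)) ν ∧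
      ∫ ω, (ThinnedDDP.numDistinct (fun _ : Unit => x) ω : ℝ) ∂ν =
        ∑ i ∈ Finset.Icc 1 m, α / (α + (i : ℝ) - 1)) ∧
    -- the two bounds on the expected total number of distinct values
    Integrable (fun ω => (ThinnedDDP.numDistinct y ω : ℝ)) μ ∧
    ∑ i ∈ Finset.Icc 1 (n 0 + n 1), α / (α + (i : ℝ) - 1) ≤
      ∫ ω, (ThinnedDDP.numDistinct y ω : ℝ) ∂μ ∧
    ∫ ω, (ThinnedDDP.numDistinct y ω : ℝ) ∂μ ≤
      ∑ i ∈ Finset.Icc 1 (n 0), α / (α + (i : ℝ) - 1) +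
        ∑ i ∈ Finset.Icc 1 (n 1), α / (α + (i : ℝ) - 1) := by
  refine ⟨?_, ThinnedDDP.integrable_numDistinct hy.measurable, ?_⟩
  · intro Ω' _ ν _ q m x hq hx
    refine ⟨ThinnedDDP.integrable_numDistinct (n := fun _ : Unit => m) hx.measurable, ?_⟩
    have h01 : ∀ _ : ℕ, (1 : ℕ) = 0 ∨ (1 : ℕ) = 1 := fun _ => Or.inr rfl
    have htop : ∑' _ : ℕ, ((1 : ℕ) : ℝ≥0∞) = ∞ := by
      simp
    have hs := ThinnedDDP.hasSum_atomProb_self h01 hα htop m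
    rw [← hs.tsum_eq]
    refine ThinnedDDP.integral_numDistinct (n := fun _ : Unit => m) hα hP₀
      ⟨fun _ => h01, fun _ => htop⟩ hq.isThinnedDDP hx (fun j => ?_) (ThinnedDDP.atomProb_nonneg h01 h01 hα m 0) hs.summable
    simp [ThinnedDDP.atomProb, ThinnedDDP.hitProb]
  · obtain ⟨hs, h1, h2⟩ := ThinnedDDP.summable_atomProb_and_bounds (hℓ.zero_or_one 0)
      (hℓ.zero_or_one 1) hα (hℓ.tsum_eq_top 0) (hℓ.tsum_eq_top 1) (n 0) (n 1)
    rw [ThinnedDDP.integral_numDistinct hα hP₀ hℓ hp hy (fun j => ?_)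
      (ThinnedDDP.atomProb_nonneg (hℓ.zero_or_one 0) (hℓ.zero_or_one 1) hα (n 0) (n 1)) hs]
    · exact ⟨h1, h2⟩
    · simp [ThinnedDDP.atomProb, ThinnedDDP.hitProb]
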